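/- **Model.** For each $n\in\mathbb N$ consider a market with $n$ potential suppliers. A global state $A$ takes values in a finite set $\mathcal A$. Given $A=a$, the following hold. * The demand $D\ge 0$ has law $F^{(n)}_a$, and for constants $d_a>0$: $E[D/n\mid A=a]=d_a$ for $n\ge 1$, $E[(D/n-d_a)^2\mid A=a]\to0$ and $P(D/n\notin[d_a/2,2d_a]\mid A=a)=o(1/n)$ as $n\to\infty$. * Payments $P_i\sim\pi$ and private features $B_i\sim\beta_a$, $1\le i\le n$, are i.i.d., independent of each other and of $D$. Supplier $i$ is active ($Z_i=1$; otherwise $Z_i=0$), independently across $i$ and independently of $D$, with $$P(Z_i=1\mid P_i,B_i,A=a)=f_{B_i}\big(P_i\,E[\Omega(D,T)\mid A=a]\big),\qquad T=\sum_{i=1}^n Z_i ,$$ where the $T$ that suppliers anticipate is the one that results from their choices (equilibrium). * An active supplier $i$ serves an amount $S_i$ of demand with $E[S_i\mid D,T,A=a]=\Omega(D,T)$. The platform's utility is $U=R(D,T)-\sum_{i} P_iZ_iS_i$, and $u^{(n)}_a(\pi)=\frac1n E[U\mid A=a]$. **Assumptions.** (Throughout, "error function" means a bounded function $l$ on $[0,\infty)^2$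 with $|l(d,t)|=o(1/\sqrt t+1/\sqrt d)$ as $d,t\to\infty$.) 1. $\Omega:[0,\infty)^2\to[0,\infty)$ is non-decreasing in $d$, non-increasing in $t$, $\Omega(\cdot,0)$ is bounded, and $\Omega(d,t)=\omega(d/t)+l(d,t)$ for $d\ge 0$, $t>0$, with an error function $l$ and a regular allocation function $\omega:[0,\infty)\to[0,1]$: $\omega$ is concave, non-decreasing, smooth on $(0,\infty)$, $\omega(0)=\lim_{x\to0}\omega(x)=0$, $\lim_{x\to\infty}\omega(x)\le1$, $\lim_{x\to0}\omega'(x)\le1$. 2. Each $f_b:[0,\infty)\to[0,1]$ is non-decreasing and twice differentiable, with second derivatives bounded uniformly in $b$ and $x$. 3. $R(d,t)=(r(d/t)-l(d,t))\,t$ for $d\ge0$, $t>0$, with an error function $l$, $R(d,0)=0$, and $r$ is smooth on $(0,\infty)$ with bounded derivative. Call a payment $p>0$ *viable in state $a$* if $E[f_{B_1}(p\,\omega(x))\mid A=a]>0$ for some $x>0$. **Theorem.** Under these assumptions, let $0<\zeta<p$, $0<\alpha<1/2$, and let $p$ be viable in every state $a\in\mathcal A$. (a) For every $a$ and every $p'>0$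 viable in state $a$, the equation $\mu=E[f_{B_1}(p'\omega(d_a/\mu))\mid A=a]$ has exactly one solution $\mu=\mu_a(p')\in(0,1]$, and when all payments equal $p'$ (and $P(A=a)>0$), $$\lim_{n\to\infty}u_a^{(n)}(\delta_{p'})=u_a(p'):=\big(r(d_a/\mu_a(p'))-p'\omega(d_a/\mu_a(p'))\big)\mu_a(p').$$ (b) For every $a$, the mean-field utility $u_a$ is differentiable at $p$. (c) Let the payments in the $n$-th market be $P_i=p+\zeta_n\varepsilon_i$ with $\zeta_n=\zeta n^{-\alpha}$ and $\varepsilon_i$ i.i.d. uniform on $\{-1,1\}$. Put $\bar D=D/n$, $\bar Z=\frac1n\sum_i Z_i$, $\bar\varepsilon=\frac1n\sum_i\varepsilon_i$, $$\hat\Delta=\zeta_n^{-1}\,\frac{\sum_{i=1}^n(Z_i-\bar Z)(\varepsilon_i-\bar\varepsilon)}{\sum_{i=1}^n(\varepsilon_i-\bar\varepsilon)^2},\qquad \hat\Upsilon=\hat\Delta\Big/\Big(1+\frac{p\,\bar D\,\hat\Delta\,\omega'(\bar D/\bar Z)}{\bar Z^2\,\omega(\bar D/\bar Z)}\Big),$$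 $$\hat\Gamma=\hat\Upsilon\Big[r(\bar D/\bar Z)-p\,\omega(\bar D/\bar Z)-\big(r'(\bar D/\bar Z)-p\,\omega'(\bar D/\bar Z)\big)\bar D/\bar Z\Big]-\omega(\bar D/\bar Z)\,\bar Z$$ (a quotient with denominator $0$ is read as $0$). Then for every $\delta>0$ $$\lim_{n\to\infty}P\big(\big|\hat\Gamma-u_A'(p)\big|>\delta\big)=0 .$$ -/

import Mathlib

open MeasureTheory ProbabilityTheory Filter Topology Asymptotics

universe u v w

noncomputable section

/-- The primitives of the stochastic market, with global states in `𝒜` and private supplier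
features in `ℬ`. Functions on `ℝ₊` are represented by functions on `ℝ` of which only the values on
`[0, ∞)` are constrained and used. -/
structure Market (𝒜 ℬ : Type*) [MeasurableSpace ℬ] where
  /-- law of the demand `D` in the `n`-th system, conditionally on `A = a` -/
  demandLaw : ℕ → 𝒜 → Measure ℝ
  /-- the constants `d_a` -/
  demandMean : 𝒜 → ℝ
  /-- law of the private feature of a supplier, conditionally on `A = a` -/
  featureLaw : 𝒜 → Measure ℬ
  /-- the choice functions `f_b(x)` -/
  choice : ℬ → ℝ → ℝ
  /-- the expected allocation `Ω(d, t)` to an active supplier -/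
  alloc : ℝ → ℝ → ℝ
  /-- the limiting allocation function `ω` -/
  allocLim : ℝ → ℝ
  /-- the platform's revenue `R(d, t)` -/
  revenue : ℝ → ℝ → ℝ
  /-- the limiting revenue function `r` -/
  revenueLim : ℝ → ℝ

/-- Regular allocation functions `ω : ℝ₊ → [0, 1]`, with `ω 0` the limit of `ω` at `0`. -/
structure IsRegularAllocation (ω : ℝ → ℝ) : Prop where
  mem_Icc : ∀ x, 0 ≤ x → ω x ∈ Set.Icc (0 : ℝ) 1
  smooth : ContDiffOn ℝ (⊤ : ℕ∞) ω (Set.Ioi 0)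
  concave : ConcaveOn ℝ (Set.Ici 0) ω
  mono : MonotoneOn ω (Set.Ici 0)
  at_zero : ω 0 = 0
  tendsto_zero : Tendsto ω (𝓝[>] 0) (𝓝 0)
  tendsto_top : ∃ c ≤ 1, Tendsto ω atTop (𝓝 c)
  deriv_zero : ∃ c ≤ 1, Tendsto (deriv ω) (𝓝[>] 0) (𝓝 c)

/-- A bounded function on `ℝ₊²` with `|l(d, t)| = o(1/√t + 1/√d)` as `d, t → ∞`. -/
structure IsErrorFunction (l : ℝ → ℝ → ℝ) : Prop where
  bounded : ∃ C, ∀ d t, 0 ≤ d → 0 ≤ t → |l d t| ≤ C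
  isLittleO : (fun x : ℝ × ℝ => l x.1 x.2) =o[atTop ×ˢ atTop]
    fun x : ℝ × ℝ => 1 / √x.2 + 1 / √x.1

namespace Market

variable {𝒜 ℬ : Type*} [MeasurableSpace ℬ]

/-- Assumptions on demand: `D ≥ 0`, `E[D/n | A = a] = d_a > 0`, `E[(D/n - d_a)² | A = a] → 0` and
`P(D/n ∉ [d_a/2, 2 d_a] | A = a) = o(1/n)`. -/
structure DemandAssumption (M : Market 𝒜 ℬ) : Prop where
  isProb : ∀ n a, IsProbabilityMeasure (M.demandLaw n a)
  nonneg : ∀ n a, ∀ᵐ x ∂M.demandLaw n a, 0 ≤ x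
  mean_pos : ∀ a, 0 < M.demandMean a
  integrable : ∀ n a, Integrable (fun x : ℝ => x) (M.demandLaw n a)
  mean_eq : ∀ n a, 0 < n → ∫ x, x / (n : ℝ) ∂M.demandLaw n a = M.demandMean a
  concentrates : ∀ a, Tendsto
    (fun n : ℕ => ∫⁻ x, ENNReal.ofReal ((x / (n : ℝ) - M.demandMean a) ^ 2) ∂M.demandLaw n a)
    atTop (𝓝 0)
  tail : ∀ a, (fun n : ℕ => (M.demandLaw n a).real
      {x | x / (n : ℝ) ∉ Set.Icc (M.demandMean a / 2) (2 * M.demandMean a)})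
    =o[atTop] fun n : ℕ => 1 / (n : ℝ)

/-- Assumptions on the allocation: monotonicity, and `Ω(d, t) = ω(d/t) + l(d, t)`. When there are no
active suppliers the ratio `d/t` is meaningless, and only boundedness remains. -/
structure AllocationAssumption (M : Market 𝒜 ℬ) : Prop where
  nonneg : ∀ d t, 0 ≤ d → 0 ≤ t → 0 ≤ M.alloc d t
  mono_demand : ∀ t, 0 ≤ t → MonotoneOn (fun d => M.alloc d t) (Set.Ici 0)
  anti_supply : ∀ d, 0 ≤ d → AntitoneOn (fun t => M.alloc d t) (Set.Ici 0)
  bounded_zero : ∃ C, ∀ d, 0 ≤ d → M.alloc d 0 ≤ C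
  regular : IsRegularAllocation M.allocLim
  approx : ∃ l : ℝ → ℝ → ℝ, IsErrorFunction l ∧
    ∀ d t, 0 ≤ d → 0 < t → M.alloc d t = M.allocLim (d / t) + l d t

/-- Assumptions on the choice functions: values in `[0, 1]`, non-decreasing, twice differentiable on
`[0, ∞)` with a second derivative that is bounded uniformly in the private feature. -/
structure ChoiceAssumption (M : Market 𝒜 ℬ) : Prop where
  isProb : ∀ a, IsProbabilityMeasure (M.featureLaw a)
  measurable : ∀ x, 0 ≤ x → Measurable fun b => M.choice b x
  mem_Icc : ∀ b x, 0 ≤ x → M.choice b x ∈ Set.Icc (0 : ℝ) 1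
  mono : ∀ b, MonotoneOn (M.choice b) (Set.Ici 0)
  twice_diff : ∃ K : ℝ, ∀ b, ∃ f' f'' : ℝ → ℝ, ∀ x, 0 ≤ x →
    HasDerivWithinAt (M.choice b) (f' x) (Set.Ici 0) x ∧
    HasDerivWithinAt f' (f'' x) (Set.Ici 0) x ∧ |f'' x| ≤ K

/-- Assumptions on the revenue: `R(d, t) = (r(d/t) - l(d, t)) t`, so that there is no revenue
without active suppliers, and `r` is smooth with bounded derivative. -/
structure RevenueAssumption (M : Market 𝒜 ℬ) : Prop where
  measurable : ∀ t, Measurable fun d => M.revenue d t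
  zero_supply : ∀ d, 0 ≤ d → M.revenue d 0 = 0
  smooth : ContDiffOn ℝ (⊤ : ℕ∞) M.revenueLim (Set.Ioi 0)
  deriv_bounded : ∃ C, ∀ x, 0 < x → |deriv M.revenueLim x| ≤ C
  approx : ∃ l : ℝ → ℝ → ℝ, IsErrorFunction l ∧
    ∀ d t, 0 ≤ d → 0 < t → M.revenue d t = (M.revenueLim (d / t) - l d t) * t

/-- At payment `p` and in state `a`, a supplier becomes active with positive probability
if demand per active supplier is abundant enough. -/
def Viable (M : Market 𝒜 ℬ) (a : 𝒜) (p : ℝ) : Prop :=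
  ∃ x > 0, 0 < ∫ b, M.choice b (p * M.allocLim x) ∂M.featureLaw a

/-- `μ ∈ (0, 1]` solves the mean-field balance equation `μ = E[f_B(p ω(d_a/μ)) | A = a]`. -/
def IsMeanFieldSupply (M : Market 𝒜 ℬ) (a : 𝒜) (p μ : ℝ) : Prop :=
  0 < μ ∧ μ ≤ 1 ∧
    μ = ∫ b, M.choice b (p * M.allocLim (M.demandMean a / μ)) ∂M.featureLaw a

/-- `μ_a(p)`, the solution of the mean-field balance equation. -/
def meanFieldSupply (M : Market 𝒜 ℬ) (a : 𝒜) (p : ℝ) : ℝ :=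
  Classical.epsilon (M.IsMeanFieldSupply a p)

/-- `u_a(p) = (r(d_a/μ_a(p)) - p ω(d_a/μ_a(p))) μ_a(p)`. -/
def meanFieldUtility (M : Market 𝒜 ℬ) (a : 𝒜) (p : ℝ) : ℝ :=
  (M.revenueLim (M.demandMean a / M.meanFieldSupply a p)
    - p * M.allocLim (M.demandMean a / M.meanFieldSupply a p)) * M.meanFieldSupply a p

end Market

/-- One period of the `n`-th market, in equilibrium, under the payment distribution `π`. The
equilibrium condition is the field `choice_eq`: the number of active suppliers that the suppliers
anticipate when they choose is, in distribution, the number `∑ j, Z j` of active suppliers that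
results from their choices. -/
structure EquilibriumPeriod {𝒜 : Type v} {ℬ : Type w} [MeasurableSpace 𝒜]
    [MeasurableSpace ℬ] (M : Market 𝒜 ℬ) (n : ℕ) (π : Measure ℝ) where
  /-- the sample space -/
  Sample : Type u
  [measurableSpace : MeasurableSpace Sample]
  /-- the probability -/
  Pr : Measure Sample
  isProb : IsProbabilityMeasure Pr
  /-- the global state -/
  A : Sample → 𝒜
  /-- the demand -/
  D : Sample → ℝ
  /-- the payments -/
  P : Fin n → Sample → ℝ
  /-- the private features -/
  B : Fin n → Sample → ℬ
  /-- the participation decisions -/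
  Z : Fin n → Sample → ℝ
  /-- the amounts of demand that active suppliers serve -/
  S : Fin n → Sample → ℝ
  measurable_A : Measurable A
  measurable_D : Measurable D
  measurable_P : ∀ i, Measurable (P i)
  measurable_B : ∀ i, Measurable (B i)
  measurable_Z : ∀ i, Measurable (Z i)
  Z_eq : ∀ i ω, Z i ω = 0 ∨ Z i ω = 1
  law_D : ∀ a, Pr (A ⁻¹' {a}) ≠ 0 → (Pr[|A ⁻¹' {a}]).map D = M.demandLaw n a
  law_PB : ∀ a, Pr (A ⁻¹' {a}) ≠ 0 → ∀ i,
    (Pr[|A ⁻¹' {a}]).map (fun ω => (P i ω, B i ω)) = π.prod (M.featureLaw a)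
  indep_suppliers : ∀ a, Pr (A ⁻¹' {a}) ≠ 0 →
    iIndepFun (fun i ω => (P i ω, B i ω, Z i ω)) (Pr[|A ⁻¹' {a}])
  indep_D : ∀ a, Pr (A ⁻¹' {a}) ≠ 0 →
    IndepFun D (fun ω i => (P i ω, B i ω, Z i ω)) (Pr[|A ⁻¹' {a}])
  /-- `P(Z_i = 1 | P_i, B_i, A = a) = f_{B_i}(P_i E[Ω(D, T) | A = a])` with `T = ∑ j, Z_j` -/
  choice_eq : ∀ a, Pr (A ⁻¹' {a}) ≠ 0 → ∀ i,
    (Pr[|A ⁻¹' {a}])[Z i | MeasurableSpace.comap (fun ω => (P i ω, B i ω)) inferInstance]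
      =ᵐ[Pr[|A ⁻¹' {a}]] fun ω => M.choice (B i ω)
        (P i ω * ∫ ω', M.alloc (D ω') (∑ j, Z j ω') ∂Pr[|A ⁻¹' {a}])
  integrable_S : ∀ a i, Integrable (S i) (Pr[|A ⁻¹' {a} ∩ Z i ⁻¹' {1}])
  /-- for an active supplier `i`, `E[S_i | D, T, A = a] = Ω(D, T)` -/
  alloc_eq : ∀ a i,
    (Pr[|A ⁻¹' {a} ∩ Z i ⁻¹' {1}])[S i |
        MeasurableSpace.comap (fun ω => (D ω, ∑ j, Z j ω)) inferInstance]
      =ᵐ[Pr[|A ⁻¹' {a} ∩ Z i ⁻¹' {1}]] fun ω => M.alloc (D ω) (∑ j, Z j ω)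

attribute [instance] EquilibriumPeriod.measurableSpace EquilibriumPeriod.isProb

/-- The expected utility `u_a^{(n)}(π) = E[R(D, T) - ∑ P_i Z_i S_i | A = a] / n`. -/
def EquilibriumPeriod.utility {𝒜 : Type v} {ℬ : Type w} [MeasurableSpace 𝒜]
    [MeasurableSpace ℬ] {M : Market 𝒜 ℬ} {n : ℕ} {π : Measure ℝ}
    (X : EquilibriumPeriod.{u} M n π) (a : 𝒜) : ℝ :=
  (1 / (n : ℝ)) * ∫ ω, (M.revenue (X.D ω) (∑ j, X.Z j ω) - ∑ i, X.P i ω * X.Z i ω * X.S i ω)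
    ∂(X.Pr)[|X.A ⁻¹' {a}]

/-- The law of `p + ζ ε` with `ε` uniform on `{-1, 1}`. -/
def perturbedPayment (p ζ : ℝ) : Measure ℝ :=
  (2⁻¹ : ENNReal) • Measure.dirac (p + ζ) + (2⁻¹ : ENNReal) • Measure.dirac (p - ζ)

/-- Sample average. -/
def sampleMean {n : ℕ} (x : Fin n → ℝ) : ℝ := (∑ i, x i) / n

/-- `Δ̂`, the regression coefficient of the `Z_i` on the perturbations `ζ ε_i`. -/
def deltaHat {n : ℕ} (ζ : ℝ) (Z ε : Fin n → ℝ) : ℝ :=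
  ζ⁻¹ * (∑ i, (Z i - sampleMean Z) * (ε i - sampleMean ε)) / ∑ i, (ε i - sampleMean ε) ^ 2

/-- `Υ̂`, as a function of `p`, `D̄`, `Z̄` and `Δ̂`. -/
def upsilonHat (ω : ℝ → ℝ) (p Dbar Zbar Δ : ℝ) : ℝ :=
  Δ / (1 + p * Dbar * Δ * deriv ω (Dbar / Zbar) / (Zbar ^ 2 * ω (Dbar / Zbar)))

/-- `Γ̂`, as a function of `p`, `D̄`, `Z̄` and `Δ̂`. -/
def gammaHat (ω r : ℝ → ℝ) (p Dbar Zbar Δ : ℝ) : ℝ :=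
  upsilonHat ω p Dbar Zbar Δ *
      (r (Dbar / Zbar) - p * ω (Dbar / Zbar)
        - (deriv r (Dbar / Zbar) - p * deriv ω (Dbar / Zbar)) * (Dbar / Zbar))
    - ω (Dbar / Zbar) * Zbar

end

/-!
When all payments are close to `p`, the equilibrium allocation `E[Ω(D, T)]` and the supply `T / n`
concentrate: along any subsequence on which the allocation converges, the law of large numbers
identifies the limit of the supply with a solution `μ` of the balance equation
`μ = E[f_B(p ω(d/μ))]`, and that solution is unique because the right side is antitone in `μ`.

Differentiating the balance equation implicitly, `u'(p)` becomes the expression that defines `Γ̂`,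
evaluated at the mean demand `d`, at `μ`, and at the partial derivative of `E[f_B(p ω(x))]` in `p`
with `x = d/μ` held fixed. The regression coefficient `Δ̂` estimates this partial derivative:
individual perturbations move individual choices, while the allocation anticipated by everyone is
common to the two signs. Its signal has size `ζ_n` against noise of size `1/√n`, so `n ζ_n² → ∞`
makes it consistent, and `Γ̂` is a continuous function of `D/n`, `T/n` and `Δ̂`.
-/

/-! ### Convergence in probability -/

section WithHighProb

variable {ι : Type*} {Ω : ι → Type*} [∀ i, MeasurableSpace (Ω i)]

/-- The filter of the events that hold with probability tending to `1` along `l`. The sample spaces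
vary with the index, so an event is a set of pairs `⟨i, ω⟩` with `ω : Ω i`; convergence in
probability is convergence along this filter. -/
def withHighProb (l : Filter ι) (P : ∀ i, Measure (Ω i)) : Filter (Σ i, Ω i) where
  sets := {s | Tendsto (fun i => P i {ω | ⟨i, ω⟩ ∉ s}) l (𝓝 0)}
  univ_sets := by simp [tendsto_const_nhds]
  sets_of_superset := fun hs hst => tendsto_of_tendsto_of_tendsto_of_le_of_le tendsto_const_nhds hs
    (fun _ => zero_le) fun _ => measure_mono fun _ hω h => hω (hst h)
  inter_sets := fun {s t} hs ht => by
    refine tendsto_of_tendsto_of_tendsto_of_le_of_le tendsto_const_nhds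
      (by simpa using hs.add ht) (fun _ => zero_le) fun i => ?_
    refine (measure_mono fun ω hω => ?_).trans (measure_union_le _ _)
    exact not_and_or.1 hω

variable {l : Filter ι} {P : ∀ i, Measure (Ω i)}

lemma eventually_withHighProb {p : (Σ i, Ω i) → Prop} :
    (∀ᶠ x in withHighProb l P, p x) ↔ Tendsto (fun i => P i {ω | ¬p ⟨i, ω⟩}) l (𝓝 0) :=
  Iff.rfl

lemma eventually_withHighProb_of_ae {p : (Σ i, Ω i) → Prop}
    (h : ∀ᶠ i in l, ∀ᵐ ω ∂P i, p ⟨i, ω⟩) : ∀ᶠ x in withHighProb l P, p x :=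
  eventually_withHighProb.2 (tendsto_const_nhds.congr' (h.mono fun _ hi => (ae_iff.1 hi).symm))

lemma tendsto_fst_withHighProb : Tendsto Sigma.fst (withHighProb l P) l := fun _ hs =>
  eventually_withHighProb_of_ae (mem_of_superset hs fun _ hi => ae_of_all _ fun _ => hi)

lemma withHighProb_mono {l' : Filter ι} (h : l' ≤ l) : withHighProb l' P ≤ withHighProb l P :=
  fun _ hs => Tendsto.mono_left hs h

lemma tendsto_withHighProb_iff {Y : (Σ i, Ω i) → ℝ} {y : ℝ} :
    Tendsto Y (withHighProb l P) (𝓝 y) ↔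
      ∀ δ > 0, Tendsto (fun i => P i {ω | δ < |Y ⟨i, ω⟩ - y|}) l (𝓝 0) := by
  rw [Metric.nhds_basis_closedBall.tendsto_right_iff]
  simp only [eventually_withHighProb, Metric.mem_closedBall, Real.dist_eq, not_le]

lemma tendsto_withHighProb_of_meanSquare {Y : (Σ i, Ω i) → ℝ} {y : ℝ}
    (hY : ∀ i, AEMeasurable (fun ω => Y ⟨i, ω⟩) (P i))
    (h : Tendsto (fun i => ∫⁻ ω, ENNReal.ofReal ((Y ⟨i, ω⟩ - y) ^ 2) ∂P i) l (𝓝 0)) :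
    Tendsto Y (withHighProb l P) (𝓝 y) := by
  refine tendsto_withHighProb_iff.2 fun δ hδ => ?_
  have hδ0 : ENNReal.ofReal (δ ^ 2) ≠ 0 := by simp [hδ.ne']
  refine tendsto_of_tendsto_of_tendsto_of_le_of_le tendsto_const_nhds
    (by simpa using ENNReal.Tendsto.div_const h (Or.inr hδ0)) (fun _ => zero_le) fun i => ?_
  refine (measure_mono fun ω hω => ?_).trans (meas_ge_le_lintegral_div
    (((hY i).sub_const y).pow_const 2).ennreal_ofReal hδ0 ENNReal.ofReal_ne_top)
  exact ENNReal.ofReal_le_ofReal (sq_le_sq' (by linarith [abs_nonneg (Y ⟨i, ω⟩ - y), hω.out])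
    hω.out.le |>.trans_eq (sq_abs _))

/-- Off the rare event `η < |Y - y|` the integrand is within `η` of `y`, and on it `|Y - y|` is at
most a constant up to the `L¹`-small error `|G - g|`. -/
lemma tendsto_integral_of_withHighProb [∀ i, IsProbabilityMeasure (P i)] {Y : (Σ i, Ω i) → ℝ}
    {G : ∀ i, Ω i → ℝ} {g y : ℝ} (hYi : ∀ i, Integrable (fun ω => Y ⟨i, ω⟩) (P i))
    (hGm : ∀ i, AEMeasurable (G i) (P i)) (hYG : ∀ᶠ i in l, ∀ᵐ ω ∂P i, |Y ⟨i, ω⟩| ≤ G i ω)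
    (hG : Tendsto (fun i => ∫⁻ ω, ‖G i ω - g‖ₑ ∂P i) l (𝓝 0))
    (hY : Tendsto Y (withHighProb l P) (𝓝 y)) :
    Tendsto (fun i => ∫ ω, Y ⟨i, ω⟩ ∂P i) l (𝓝 y) := by
  refine Metric.nhds_basis_ball.tendsto_right_iff.2 fun η hη => ?_
  set bad : ∀ i, Set (Ω i) := fun i => {ω | η / 2 < |Y ⟨i, ω⟩ - y|}
  set H := ENNReal.ofReal (|g| + |y|)
  have hpoint : ∀ᶠ i in l, ∀ᵐ ω ∂P i, ‖Y ⟨i, ω⟩ - y‖ₑ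
      ≤ ENNReal.ofReal (η / 2) + ((bad i).indicator (fun _ => H) ω + ‖G i ω - g‖ₑ) := by
    filter_upwards [hYG] with i hi
    filter_upwards [hi] with ω hω
    by_cases hbad : ω ∈ bad i
    · rw [Set.indicator_of_mem hbad, Real.enorm_eq_ofReal_abs, Real.enorm_eq_ofReal_abs]
      refine le_add_left ?_
      rw [← ENNReal.ofReal_add (by positivity) (by positivity)]
      refine ENNReal.ofReal_le_ofReal ?_
      linarith [abs_sub (Y ⟨i, ω⟩) y, le_abs_self (G i ω - g), le_abs_self g]
    · rw [Real.enorm_eq_ofReal_abs]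
      exact le_add_right (ENNReal.ofReal_le_ofReal (not_lt.1 hbad))
  have hlim : Tendsto (fun i => ENNReal.ofReal (η / 2)
      + (H * P i (bad i) + ∫⁻ ω, ‖G i ω - g‖ₑ ∂P i)) l (𝓝 (ENNReal.ofReal (η / 2))) := by
    have hbad := ENNReal.Tendsto.const_mul (a := H)
      (tendsto_withHighProb_iff.1 hY (η / 2) (by positivity)) (Or.inr ENNReal.ofReal_ne_top)
    simpa using (tendsto_const_nhds (x := ENNReal.ofReal (η / 2))).add (hbad.add hG)
  filter_upwards [hpoint, hlim.eventually_lt_const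
    ((ENNReal.ofReal_lt_ofReal_iff hη).2 (half_lt_self hη))] with i hi hlt
  rw [Metric.mem_ball, ← ENNReal.ofReal_lt_ofReal_iff hη, ← edist_dist, edist_eq_enorm_sub]
  calc ‖∫ ω, Y ⟨i, ω⟩ ∂P i - y‖ₑ = ‖∫ ω, (Y ⟨i, ω⟩ - y) ∂P i‖ₑ := by
        simp [integral_sub (hYi i) (integrable_const y)]
    _ ≤ ∫⁻ ω, ‖Y ⟨i, ω⟩ - y‖ₑ ∂P i := enorm_integral_le_lintegral_enorm _
    _ ≤ _ := lintegral_mono_ae hi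
    _ ≤ ENNReal.ofReal (η / 2) + (H * P i (bad i) + ∫⁻ ω, ‖G i ω - g‖ₑ ∂P i) := by
        rw [lintegral_add_left measurable_const,
          lintegral_add_right' _ ((hGm i).sub_const g).enorm, lintegral_const, measure_univ,
          mul_one]
        gcongr
        exact lintegral_indicator_const_le _ _
    _ < ENNReal.ofReal η := hlt

lemma tendsto_integral_of_withHighProb_of_bounded [∀ i, IsProbabilityMeasure (P i)]
    {Y : (Σ i, Ω i) → ℝ} {C y : ℝ} (hYm : ∀ i, AEStronglyMeasurable (fun ω => Y ⟨i, ω⟩) (P i))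
    (hYC : ∀ i, ∀ᵐ ω ∂P i, |Y ⟨i, ω⟩| ≤ C) (hY : Tendsto Y (withHighProb l P) (𝓝 y)) :
    Tendsto (fun i => ∫ ω, Y ⟨i, ω⟩ ∂P i) l (𝓝 y) :=
  tendsto_integral_of_withHighProb (G := fun _ _ => C) (g := C)
    (fun i => .of_bound (hYm i) C (hYC i)) (fun _ => aemeasurable_const) (.of_forall hYC)
    (by simp [tendsto_const_nhds]) hY

lemma eventually_withHighProb_of_cond [∀ i, IsProbabilityMeasure (P i)] {𝒜 : Type*} [Finite 𝒜]
    [MeasurableSpace 𝒜] [MeasurableSingletonClass 𝒜] {A : ∀ i, Ω i → 𝒜}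
    (hA : ∀ i, Measurable (A i)) {s : (Σ i, Ω i) → Prop}
    (h : ∀ a, ∀ᶠ x in withHighProb (comap Subtype.val l)
      (fun i : {i // P i (A i ⁻¹' {a}) ≠ 0} => (P i)[|A i ⁻¹' {a}]),
        A x.1 x.2 = a → s ⟨x.1, x.2⟩) :
    ∀ᶠ x in withHighProb l P, s x := by
  have := Fintype.ofFinite 𝒜
  set bad : 𝒜 → ∀ i, Set (Ω i) := fun a i => {ω | ¬(A i ω = a → s ⟨i, ω⟩)}
  have hstate : ∀ a, Tendsto (fun i => P i (A i ⁻¹' {a} ∩ bad a i)) l (𝓝 0) := fun a => by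
    refine ENNReal.tendsto_nhds_zero.2 fun δ hδ => ?_
    filter_upwards [eventually_comap.1 (ENNReal.tendsto_nhds_zero.1
      (eventually_withHighProb.1 (h a)) δ hδ)] with i hi
    by_cases ha : P i (A i ⁻¹' {a}) = 0
    · exact (measure_mono_null Set.inter_subset_left ha).trans_le zero_le
    calc P i (A i ⁻¹' {a} ∩ bad a i) = (P i)[bad a i|A i ⁻¹' {a}] * P i (A i ⁻¹' {a}) :=
          (cond_mul_eq_inter (hA i (measurableSet_singleton a)) _ _).symm
      _ ≤ (P i)[bad a i|A i ⁻¹' {a}] := mul_le_of_le_one_right zero_le prob_le_one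
      _ ≤ δ := hi ⟨i, ha⟩ rfl
  refine tendsto_of_tendsto_of_tendsto_of_le_of_le tendsto_const_nhds
    (by simpa using tendsto_finsetSum Finset.univ fun a _ => hstate a) (fun _ => zero_le)
    fun i => (measure_mono fun ω hω => ?_).trans (measure_biUnion_finset_le _ _)
  exact Set.mem_biUnion (Finset.mem_univ (A i ω)) ⟨rfl, fun hs => hω (hs rfl)⟩

/-! ### The law of large numbers for triangular arrays -/

lemma variance_sampleMean_le {Ω : Type*} [MeasurableSpace Ω] {P : Measure Ω}
    [IsProbabilityMeasure P] {n : ℕ} {W : Fin n → Ω → ℝ} (hW : ∀ k, AEMeasurable (W k) P)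
    (hindep : Pairwise fun j k => IndepFun (W j) (W k) P)
    (hbd : ∀ k, ∀ᵐ ω ∂P, W k ω ∈ Set.Icc (-1 : ℝ) 1) :
    variance (fun ω => sampleMean fun k => W k ω) P ≤ 1 / n := by
  have hLp : ∀ k, MemLp (W k) 2 P := fun k =>
    memLp_of_bounded (hbd k) (hW k).aestronglyMeasurable 2
  have hsum : variance (∑ k, W k) P ≤ n := by
    rw [IndepFun.variance_sum (fun k _ => hLp k) fun j _ k _ hjk => hindep hjk]
    calc ∑ k, variance (W k) P ≤ ∑ _k : Fin n, (1 : ℝ) := Finset.sum_le_sum fun k _ => by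
          simpa using variance_le_sq_of_bounded (hbd k) (hW k)
      _ = n := by simp
  have hmean : (fun ω => sampleMean fun k => W k ω) = fun ω => (n : ℝ)⁻¹ * (∑ k, W k) ω := by
    funext ω
    rw [sampleMean, Finset.sum_apply, div_eq_inv_mul]
  rw [hmean, variance_const_mul]
  calc (n : ℝ)⁻¹ ^ 2 * variance (∑ k, W k) P ≤ (n : ℝ)⁻¹ ^ 2 * (n : ℝ) := by gcongr
    _ = 1 / (n : ℝ) := by
      rcases eq_or_ne (n : ℝ) 0 with h | h
      · simp [h]
      · field_simp

lemma integral_sampleMean {Ω : Type*} [MeasurableSpace Ω] {P : Measure Ω} {n : ℕ} (hn : n ≠ 0)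
    {W : Fin n → Ω → ℝ} (hW : ∀ k, Integrable (W k) P) {m : ℝ} (hm : ∀ k, ∫ ω, W k ω ∂P = m) :
    ∫ ω, sampleMean (fun k => W k ω) ∂P = m := by
  simp only [sampleMean, integral_div, integral_finsetSum _ fun k _ => hW k, hm]
  simp [hn]

lemma tendsto_sampleMean_div [∀ i, IsProbabilityMeasure (P i)] {N : ι → ℕ} {c m : ι → ℝ} {y : ℝ}
    (hc : Tendsto (fun i => N i * c i ^ 2) l atTop) {W : ∀ i, Fin (N i) → Ω i → ℝ}
    (hW : ∀ i k, AEMeasurable (W i k) (P i))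
    (hindep : ∀ i, Pairwise fun j k => IndepFun (W i j) (W i k) (P i))
    (hbd : ∀ i k, ∀ᵐ ω ∂P i, W i k ω ∈ Set.Icc (-1 : ℝ) 1)
    (hm : ∀ i k, ∫ ω, W i k ω ∂P i = m i) (hy : Tendsto (fun i => m i / c i) l (𝓝 y)) :
    Tendsto (fun x : Σ i, Ω i => sampleMean (fun k => W x.1 k x.2) / c x.1)
      (withHighProb l P) (𝓝 y) := by
  set S : ∀ i, Ω i → ℝ := fun i ω => sampleMean fun k => W i k ω
  have hLp : ∀ i k, MemLp (W i k) 2 (P i) := fun i k =>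
    memLp_of_bounded (hbd i k) (hW i k).aestronglyMeasurable 2
  have hS : ∀ i, MemLp (S i) 2 (P i) := fun i => by
    simpa [S, sampleMean, div_eq_inv_mul] using
      (memLp_finsetSum Finset.univ fun k _ => hLp i k).const_mul (N i : ℝ)⁻¹
  have hcentered : Tendsto (fun x : Σ i, Ω i => (S x.1 x.2 - m x.1) / c x.1)
      (withHighProb l P) (𝓝 0) := by
    refine tendsto_withHighProb_of_meanSquare
      (fun i => ((hS i).aestronglyMeasurable.aemeasurable.sub_const (m i)).div_const (c i)) ?_
    refine tendsto_of_tendsto_of_tendsto_of_le_of_le' tendsto_const_nhds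
      (ENNReal.ofReal_zero ▸ ENNReal.tendsto_ofReal (tendsto_inv_atTop_zero.comp hc))
      (.of_forall fun _ => zero_le) ?_
    filter_upwards [hc.eventually_gt_atTop 0] with i hi
    have hN : N i ≠ 0 := by rintro h; simp [h] at hi
    have hmean : ∫ ω, S i ω ∂P i = m i :=
      integral_sampleMean hN (fun k => (hLp i k).integrable one_le_two) (hm i)
    calc ∫⁻ ω, ENNReal.ofReal (((S i ω - m i) / c i - 0) ^ 2) ∂P i
        = ENNReal.ofReal ((c i ^ 2)⁻¹) * evariance (S i) (P i) := by
          rw [evariance_eq_lintegral_ofReal, hmean,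
            ← lintegral_const_mul' _ _ ENNReal.ofReal_ne_top]
          refine lintegral_congr fun ω => ?_
          rw [← ENNReal.ofReal_mul (by positivity), sub_zero, div_pow, div_eq_inv_mul]
      _ ≤ ENNReal.ofReal ((c i ^ 2)⁻¹) * ENNReal.ofReal (1 / N i) := by
          rw [← ofReal_variance (hS i)]
          gcongr
          exact variance_sampleMean_le (hW i) (hindep i) (hbd i)
      _ = ENNReal.ofReal (N i * c i ^ 2)⁻¹ := by
          rw [← ENNReal.ofReal_mul (by positivity), one_div, ← mul_inv_rev]
  simpa [← add_div] using hcentered.add (hy.comp tendsto_fst_withHighProb)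

end WithHighProb

/-! ### The mean choice function -/

lemma abs_sub_sub_deriv_mul_le {f f' : ℝ → ℝ} {s : Set ℝ} (hs : Convex ℝ s) {x K : ℝ}
    (hf : ∀ y ∈ s, HasDerivWithinAt f (f' y) s y)
    (hf' : ∀ y ∈ s, |f' y - f' x| ≤ K * |y - x|) {y z : ℝ} (hy : y ∈ s) (hz : z ∈ s) :
    |f y - f z - f' x * (y - z)| ≤ |K| * max |y - x| |z - x| * |y - z| := by
  set r := max |y - x| |z - x|
  have hderiv : ∀ w ∈ s ∩ Metric.closedBall x r,
      HasDerivWithinAt (fun w => f w - f' x * w) (f' w - f' x) (s ∩ Metric.closedBall x r) w :=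
    fun w hw => by
      simpa only [mul_one, id] using ((hf w hw.1).fun_sub
        ((hasDerivWithinAt_id w s).const_mul (f' x))).mono Set.inter_subset_left
  have hbound : ∀ w ∈ s ∩ Metric.closedBall x r, ‖f' w - f' x‖ ≤ |K| * r := fun w hw => by
    have hwr : |w - x| ≤ r := hw.2
    calc |f' w - f' x| ≤ K * |w - x| := hf' w hw.1
      _ ≤ |K| * r := by gcongr; exact le_abs_self K
  have := (hs.inter (convex_closedBall x r)).norm_image_sub_le_of_norm_hasDerivWithin_le hderiv
    hbound ⟨hz, Metric.mem_closedBall.2 (le_max_right _ _)⟩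
    ⟨hy, Metric.mem_closedBall.2 (le_max_left _ _)⟩
  rw [Real.norm_eq_abs, Real.norm_eq_abs] at this
  convert this using 2
  ring

/-- The filter `𝓝[s] x ×ˢ 𝓝[s] x` makes this strict differentiability within `s`. -/
lemma hasDerivAtFilter_integral {ℬ : Type*} [MeasurableSpace ℬ] {β : Measure ℬ}
    [IsFiniteMeasure β] {f f' : ℬ → ℝ → ℝ} {s : Set ℝ} (hs : Convex ℝ s) {x K : ℝ}
    (hf : ∀ b, ∀ y ∈ s, HasDerivWithinAt (f b) (f' b y) s y)
    (hf' : ∀ b, ∀ y ∈ s, |f' b y - f' b x| ≤ K * |y - x|)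
    (hint : ∀ y ∈ s, Integrable (fun b => f b y) β) (hint' : Integrable (fun b => f' b x) β) :
    HasDerivAtFilter (fun y => ∫ b, f b y ∂β) (∫ b, f' b x ∂β) (𝓝[s] x ×ˢ 𝓝[s] x) := by
  rw [hasDerivAtFilter_iff_isLittleO]
  have hsmall : (fun y : ℝ × ℝ => |K| * max |y.1 - x| |y.2 - x| * β.real Set.univ)
      =o[𝓝[s] x ×ˢ 𝓝[s] x] fun _ => (1 : ℝ) := by
    rw [isLittleO_one_iff]
    have : Continuous fun y : ℝ × ℝ => |K| * max |y.1 - x| |y.2 - x| * β.real Set.univ := by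
      fun_prop
    refine (this.tendsto' (x, x) 0 (by simp)).mono_left ?_
    rw [nhds_prod_eq]
    exact prod_mono nhdsWithin_le_nhds nhdsWithin_le_nhds
  have hprod := hsmall.mul_isBigO (isBigO_refl (fun y : ℝ × ℝ => y.1 - y.2) (𝓝[s] x ×ˢ 𝓝[s] x))
  simp only [one_mul] at hprod
  refine IsBigO.trans_isLittleO (.of_bound 1 ?_) hprod
  filter_upwards [prod_mem_prod self_mem_nhdsWithin self_mem_nhdsWithin] with y hy
  calc ‖∫ b, f b y.1 ∂β - ∫ b, f b y.2 ∂β - (y.1 - y.2) • ∫ b, f' b x ∂β‖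
      = ‖∫ b, (f b y.1 - f b y.2 - f' b x * (y.1 - y.2)) ∂β‖ := by
        rw [integral_sub (f := fun b => f b y.1 - f b y.2) ((hint _ hy.1).sub (hint _ hy.2))
            (hint'.mul_const _),
          integral_sub (hint _ hy.1) (hint _ hy.2), integral_mul_const, smul_eq_mul,
          mul_comm (y.1 - y.2)]
    _ ≤ |K| * max |y.1 - x| |y.2 - x| * |y.1 - y.2| * β.real Set.univ :=
        norm_integral_le_of_norm_le_const (.of_forall fun b =>
          abs_sub_sub_deriv_mul_le hs (hf b) (hf' b) hy.1 hy.2)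
    _ ≤ 1 * ‖|K| * max |y.1 - x| |y.2 - x| * β.real Set.univ * (y.1 - y.2)‖ := by
        rw [one_mul, norm_mul, Real.norm_of_nonneg (r := |K| * max |y.1 - x| |y.2 - x| * _)
          (by positivity), Real.norm_eq_abs, mul_right_comm]

namespace Market

variable {𝒜 : Type v} {ℬ : Type w} [MeasurableSpace ℬ] {M : Market 𝒜 ℬ}

/-- The probability `E[f_B(x) | A = a]` that a supplier who anticipates the reward `x` becomes
active. -/
noncomputable def choiceMean (M : Market 𝒜 ℬ) (a : 𝒜) (x : ℝ) : ℝ :=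
  ∫ b, M.choice b x ∂M.featureLaw a

namespace ChoiceAssumption

lemma integrable_choice (hf : M.ChoiceAssumption) (a : 𝒜) {x : ℝ} (hx : 0 ≤ x) :
    Integrable (fun b => M.choice b x) (M.featureLaw a) := by
  have := hf.isProb a
  exact .of_mem_Icc 0 1 (hf.measurable x hx).aemeasurable (.of_forall fun b => hf.mem_Icc b x hx)

lemma choiceMean_mem_Icc (hf : M.ChoiceAssumption) (a : 𝒜) {x : ℝ} (hx : 0 ≤ x) :
    M.choiceMean a x ∈ Set.Icc (0 : ℝ) 1 := by
  have := hf.isProb a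
  refine ⟨integral_nonneg fun b => (hf.mem_Icc b x hx).1, ?_⟩
  exact (integral_mono (hf.integrable_choice a hx) (integrable_const 1)
    fun b => (hf.mem_Icc b x hx).2).trans_eq (by simp)

lemma monotoneOn_choiceMean (hf : M.ChoiceAssumption) (a : 𝒜) :
    MonotoneOn (M.choiceMean a) (Set.Ici 0) := fun _ hx _ hy hxy =>
  integral_mono (hf.integrable_choice a hx) (hf.integrable_choice a hy)
    fun b => hf.mono b hx hy hxy

lemma measurable_choice (hf : M.ChoiceAssumption) :
    Measurable fun y : ℝ × ℬ => M.choice y.2 (max y.1 0) := by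
  obtain ⟨K, hK⟩ := hf.twice_diff
  refine measurable_uncurry_of_continuous_of_measurable
    (u := fun x b => M.choice b (max x 0)) (fun b => ?_) fun x => hf.measurable _ (le_max_right x 0)
  obtain ⟨f', f'', h⟩ := hK b
  have hcont : ContinuousOn (M.choice b) (Set.Ici 0) := fun x hx => (h x hx).1.continuousWithinAt
  exact hcont.comp_continuous (by fun_prop) fun x => le_max_right x 0

lemma exists_lipschitz_deriv (hf : M.ChoiceAssumption) :
    ∃ (f' : ℬ → ℝ → ℝ) (K : ℝ),
      (∀ b, ∀ x ∈ Set.Ici 0, HasDerivWithinAt (M.choice b) (f' b x) (Set.Ici 0) x) ∧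
      ∀ b, ∀ x ∈ Set.Ici 0, ∀ y ∈ Set.Ici 0, |f' b y - f' b x| ≤ K * |y - x| := by
  obtain ⟨K, hK⟩ := hf.twice_diff
  choose f' f'' h using hK
  exact ⟨f', K, fun b x hx => (h b x hx).1, fun b x hx y hy =>
    (convex_Ici 0).norm_image_sub_le_of_norm_hasDerivWithin_le (fun z hz => (h b z hz).2.1)
      (fun z hz => (h b z hz).2.2) hx hy⟩

lemma integrable_deriv_choice (hf : M.ChoiceAssumption) (a : 𝒜) {f' : ℬ → ℝ → ℝ} {K x : ℝ}
    (hx : 0 ≤ x)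
    (hf' : ∀ b, ∀ y ∈ Set.Ici 0, HasDerivWithinAt (M.choice b) (f' b y) (Set.Ici 0) y)
    (hlip : ∀ b, ∀ y ∈ Set.Ici 0, |f' b y - f' b x| ≤ K * |y - x|) :
    Integrable (fun b => f' b x) (M.featureLaw a) := by
  have := hf.isProb a
  have hmeas : Measurable fun b => f' b x := by
    refine measurable_of_tendsto_metrizable
      (f := fun (n : ℕ) b => slope (M.choice b) x (x + ((n : ℝ) + 1)⁻¹)) (fun n => ?_) ?_
    · simp only [slope_def_field]
      exact ((hf.measurable _ (by positivity)).sub (hf.measurable x hx)).div_const _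
    · refine tendsto_pi_nhds.2 fun b => ?_
      refine ((hasDerivWithinAt_iff_tendsto_slope' (lt_irrefl x)).1
        ((hf' b x hx).mono (Set.Ioi_subset_Ici hx))).comp ?_
      refine tendsto_nhdsWithin_iff.2 ⟨?_, .of_forall fun n => ?_⟩
      · simpa using tendsto_const_nhds.add
          (tendsto_inv_atTop_zero.comp (tendsto_atTop_add_const_right _ 1
            (tendsto_natCast_atTop_atTop (R := ℝ))))
      · exact lt_add_of_pos_right x (by positivity)
  refine .of_bound hmeas.aestronglyMeasurable (|K| + 1) (.of_forall fun b => ?_)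
  have htaylor := abs_sub_sub_deriv_mul_le (convex_Ici 0) (hf' b) (hlip b)
    (Set.mem_Ici.2 (by positivity : 0 ≤ x + 1)) (Set.mem_Ici.2 hx)
  have hincr : |M.choice b (x + 1) - M.choice b x| ≤ 1 := by
    have h₁ := hf.mem_Icc b x hx
    have h₂ := hf.mem_Icc b (x + 1) (by positivity)
    exact abs_le.2 ⟨by linarith [h₁.2, h₂.1], by linarith [h₁.1, h₂.2]⟩
  simp only [add_sub_cancel_left, sub_self, abs_one, abs_zero, mul_one,
    max_eq_left zero_le_one] at htaylor
  calc |f' b x| = |(M.choice b (x + 1) - M.choice b x)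
        - (M.choice b (x + 1) - M.choice b x - f' b x)| := by rw [sub_sub_cancel]
    _ ≤ 1 + |K| := (abs_sub _ _).trans (add_le_add hincr htaylor)
    _ = |K| + 1 := add_comm _ _

lemma hasDerivAtFilter_choiceMean (hf : M.ChoiceAssumption) (a : 𝒜) {x : ℝ} (hx : 0 ≤ x) :
    HasDerivAtFilter (M.choiceMean a) (derivWithin (M.choiceMean a) (Set.Ici 0) x)
      (𝓝[Set.Ici 0] x ×ˢ 𝓝[Set.Ici 0] x) := by
  have := hf.isProb a
  obtain ⟨f', K, hf', hlip⟩ := hf.exists_lipschitz_deriv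
  have h : HasDerivAtFilter (M.choiceMean a) (∫ b, f' b x ∂M.featureLaw a)
      (𝓝[Set.Ici 0] x ×ˢ 𝓝[Set.Ici 0] x) :=
    hasDerivAtFilter_integral (convex_Ici 0) hf' (fun b => hlip b x hx)
      (fun y hy => hf.integrable_choice a hy)
      (hf.integrable_deriv_choice a hx hf' fun b => hlip b x hx)
  have hwithin : HasDerivWithinAt (M.choiceMean a) (∫ b, f' b x ∂M.featureLaw a) (Set.Ici 0) x :=
    h.mono (prod_mono le_rfl (pure_le_nhdsWithin hx))
  rwa [hwithin.derivWithin (uniqueDiffOn_Ici 0 x hx)]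

lemma hasStrictDerivAt_choiceMean (hf : M.ChoiceAssumption) (a : 𝒜) {x : ℝ} (hx : 0 < x) :
    HasStrictDerivAt (M.choiceMean a) (derivWithin (M.choiceMean a) (Set.Ici 0) x) x := by
  have h := hf.hasDerivAtFilter_choiceMean a hx.le
  rwa [nhdsWithin_eq_nhds.2 (Ici_mem_nhds hx), ← nhds_prod_eq] at h

lemma continuousOn_choiceMean (hf : M.ChoiceAssumption) (a : 𝒜) :
    ContinuousOn (M.choiceMean a) (Set.Ici 0) := fun _ hx =>
  HasDerivWithinAt.continuousWithinAt <|
    (hf.hasDerivAtFilter_choiceMean a hx).mono (prod_mono le_rfl (pure_le_nhdsWithin hx))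

lemma derivWithin_choiceMean_nonneg (hf : M.ChoiceAssumption) (a : 𝒜) (x : ℝ) :
    0 ≤ derivWithin (M.choiceMean a) (Set.Ici 0) x :=
  (hf.monotoneOn_choiceMean a).derivWithin_nonneg

end ChoiceAssumption

end Market

/-! ### Mean-field supply and utility -/

lemma hasDerivAt_of_contDiffOn_Ioi {r : ℝ → ℝ} (h : ContDiffOn ℝ (⊤ : ℕ∞) r (Set.Ioi 0))
    {x : ℝ} (hx : 0 < x) : HasDerivAt r (deriv r x) x :=
  ((h.contDiffAt (Ioi_mem_nhds hx)).differentiableAt (by simp)).hasDerivAt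

lemma continuousAt_deriv_of_contDiffOn_Ioi {r : ℝ → ℝ}
    (h : ContDiffOn ℝ (⊤ : ℕ∞) r (Set.Ioi 0)) {x : ℝ} (hx : 0 < x) : ContinuousAt (deriv r) x :=
  (h.continuousOn_deriv_of_isOpen isOpen_Ioi (by simp)).continuousAt (Ioi_mem_nhds hx)

namespace IsRegularAllocation

variable {ω : ℝ → ℝ}

lemma hasDerivAt (h : IsRegularAllocation ω) {x : ℝ} (hx : 0 < x) :
    HasDerivAt ω (deriv ω x) x :=
  hasDerivAt_of_contDiffOn_Ioi h.smooth hx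

lemma deriv_nonneg (h : IsRegularAllocation ω) {x : ℝ} (hx : 0 < x) : 0 ≤ deriv ω x := by
  rw [← (h.hasDerivAt hx).hasDerivWithinAt.derivWithin (uniqueDiffOn_Ici 0 x hx.le)]
  exact h.mono.derivWithin_nonneg

lemma eq_zero_or_pos (h : IsRegularAllocation ω) :
    (∀ x, 0 ≤ x → ω x = 0) ∨ ∀ x, 0 < x → 0 < ω x := by
  by_contra! hcon
  obtain ⟨⟨y, hy, hy'⟩, x, hx, hx'⟩ := hcon
  have hypos : 0 < ω y := (h.mem_Icc y hy).1.lt_of_ne hy'.symm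
  have hxy : x < y := lt_of_not_ge fun hle => by linarith [h.mono hy hx.le hle]
  have hy0 : 0 < y := hx.trans hxy
  have hconcave : x / y * ω y ≤ ω x := by
    simpa [h.at_zero, div_mul_cancel₀ x hy0.ne'] using
      h.concave.2 (Set.mem_Ici.2 le_rfl) (Set.mem_Ici.2 hy)
        (sub_nonneg.2 ((div_le_one hy0).2 hxy.le)) (by positivity) (sub_add_cancel 1 (x / y))
  have : 0 < x / y * ω y := by positivity
  linarith

end IsRegularAllocation

namespace Market

variable {𝒜 : Type v} {ℬ : Type w} [MeasurableSpace ℬ] {M : Market 𝒜 ℬ} {a : 𝒜} {p μ ν : ℝ}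

lemma choiceMean_allocLim_mono (hΩ : M.AllocationAssumption) (hf : M.ChoiceAssumption)
    (hp : 0 ≤ p) {x y : ℝ} (hx : 0 ≤ x) (hxy : x ≤ y) :
    M.choiceMean a (p * M.allocLim x) ≤ M.choiceMean a (p * M.allocLim y) := by
  have hωx := (hΩ.regular.mem_Icc x hx).1
  have hωxy := hΩ.regular.mono hx (hx.trans hxy) hxy
  exact hf.monotoneOn_choiceMean a (mul_nonneg hp hωx) (mul_nonneg hp (hωx.trans hωxy))
    (mul_le_mul_of_nonneg_left hωxy hp)

lemma IsMeanFieldSupply.le (hD : M.DemandAssumption) (hΩ : M.AllocationAssumption)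
    (hf : M.ChoiceAssumption) (hp : 0 ≤ p) (hμ : M.IsMeanFieldSupply a p μ)
    (hν : M.IsMeanFieldSupply a p ν) : μ ≤ ν := by
  by_contra! hlt
  have hd := hD.mean_pos a
  have : μ ≤ ν := by
    rw [hμ.2.2, hν.2.2]
    exact choiceMean_allocLim_mono hΩ hf hp (div_pos hd hμ.1).le
      (div_le_div_of_nonneg_left hd.le hν.1 hlt.le)
  exact hlt.not_ge this

lemma IsMeanFieldSupply.unique (hD : M.DemandAssumption) (hΩ : M.AllocationAssumption)
    (hf : M.ChoiceAssumption) (hp : 0 ≤ p) (hμ : M.IsMeanFieldSupply a p μ)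
    (hν : M.IsMeanFieldSupply a p ν) : μ = ν :=
  le_antisymm (hμ.le hD hΩ hf hp hν) (hν.le hD hΩ hf hp hμ)

lemma IsMeanFieldSupply.meanFieldSupply_eq (hD : M.DemandAssumption)
    (hΩ : M.AllocationAssumption) (hf : M.ChoiceAssumption) (hp : 0 ≤ p)
    (hμ : M.IsMeanFieldSupply a p μ) : M.meanFieldSupply a p = μ :=
  IsMeanFieldSupply.unique hD hΩ hf hp (Classical.epsilon_spec ⟨μ, hμ⟩) hμ

lemma continuousOn_choiceMean_allocLim_div (hD : M.DemandAssumption)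
    (hΩ : M.AllocationAssumption) (hf : M.ChoiceAssumption) (hp : 0 ≤ p) :
    ContinuousOn (fun m => M.choiceMean a (p * M.allocLim (M.demandMean a / m)))
      (Set.Ioi 0) := by
  have hω : ContinuousOn M.allocLim (Set.Ioi 0) := hΩ.regular.smooth.continuousOn
  have hdiv : Set.MapsTo (fun m => M.demandMean a / m) (Set.Ioi 0) (Set.Ioi 0) :=
    fun m hm => div_pos (hD.mean_pos a) hm
  refine (hf.continuousOn_choiceMean a).comp (continuousOn_const.mul (hω.comp
    (continuousOn_const.div continuousOn_id fun m hm => hm.ne') hdiv)) fun m hm => ?_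
  exact mul_nonneg hp (hΩ.regular.mem_Icc _ (hdiv hm).le).1

namespace Viable

lemma exists_isMeanFieldSupply (hD : M.DemandAssumption) (hΩ : M.AllocationAssumption)
    (hf : M.ChoiceAssumption) (hp : 0 ≤ p) (hv : M.Viable a p) :
    ∃ μ, M.IsMeanFieldSupply a p μ := by
  obtain ⟨x, hx, hpos⟩ := hv
  have hd := hD.mean_pos a
  set d := M.demandMean a
  set c := M.choiceMean a (p * M.allocLim x)
  set m := min c (min (d / x) 1)
  have hm : 0 < m := lt_min hpos (lt_min (div_pos hd hx) one_pos)
  have hm1 : m ≤ 1 := (min_le_right _ _).trans (min_le_right _ _)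
  have hle : m ≤ M.choiceMean a (p * M.allocLim (d / m)) :=
    (min_le_left _ _).trans <| choiceMean_allocLim_mono hΩ hf hp hx.le <|
      (le_div_comm₀ hx hm).2 ((min_le_right _ _).trans (min_le_left _ _))
  have hge : M.choiceMean a (p * M.allocLim (d / 1)) ≤ 1 :=
    (hf.choiceMean_mem_Icc a (mul_nonneg hp (hΩ.regular.mem_Icc _ (by positivity)).1)).2
  have hcont := ((continuousOn_choiceMean_allocLim_div hD hΩ hf hp (a := a)).sub
    continuousOn_id).mono fun y (hy : y ∈ Set.Icc m 1) => hm.trans_le hy.1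
  obtain ⟨μ, hμ, hzero⟩ := intermediate_value_Icc' hm1 hcont
    (show (0 : ℝ) ∈ Set.Icc _ _ from ⟨sub_nonpos.2 hge, sub_nonneg.2 hle⟩)
  exact ⟨μ, hm.trans_le hμ.1, hμ.2, (sub_eq_zero.1 hzero).symm⟩

lemma isMeanFieldSupply (hD : M.DemandAssumption) (hΩ : M.AllocationAssumption)
    (hf : M.ChoiceAssumption) (hp : 0 ≤ p) (hv : M.Viable a p) :
    M.IsMeanFieldSupply a p (M.meanFieldSupply a p) :=
  Classical.epsilon_spec (hv.exists_isMeanFieldSupply hD hΩ hf hp)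

end Viable

/-- The limit of the regression coefficient `Δ̂`: the derivative in `p` of `E[f_B(p ω(x)) | A = a]`
at fixed `x = d_a/μ_a(p)`, that is, of the supply when the congestion does not react. -/
noncomputable def supplyResponse (M : Market 𝒜 ℬ) (a : 𝒜) (p : ℝ) : ℝ :=
  M.allocLim (M.demandMean a / M.meanFieldSupply a p) *
    derivWithin (M.choiceMean a) (Set.Ici 0)
      (p * M.allocLim (M.demandMean a / M.meanFieldSupply a p))

end Market

lemma exists_hasDerivAt_of_hasStrictFDerivAt {f : ℝ × ℝ → ℝ} {f' : ℝ × ℝ →L[ℝ] ℝ} {u : ℝ × ℝ}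
    (hf : HasStrictFDerivAt f f' u) (h : f' (0, 1) ≠ 0) :
    ∃ ψ : ℝ → ℝ, HasDerivAt ψ (-(f' (1, 0) / f' (0, 1))) u.1 ∧ Tendsto ψ (𝓝 u.1) (𝓝 u.2) ∧
      ∀ᶠ x in 𝓝 u.1, f (x, ψ x) = f u := by
  have hinr : f' ∘L .inr ℝ ℝ ℝ = ContinuousLinearEquiv.unitsEquivAut ℝ (Units.mk0 _ h) := by
    ext
    simp
  have hinv : (f' ∘L .inr ℝ ℝ ℝ).IsInvertible := ⟨_, hinr.symm⟩
  refine ⟨hf.implicitFunctionOfProdDomain hinv, ?_, hf.tendsto_implicitFunctionOfProdDomain hinv,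
    hf.eventually_apply_implicitFunctionOfProdDomain hinv⟩
  refine (hf.hasStrictFDerivAt_implicitFunctionOfProdDomain hinv).hasFDerivAt.hasDerivAt.congr_deriv
    ?_
  rw [hinr, ContinuousLinearMap.inverse_equiv]
  simp [div_eq_mul_inv]

namespace Market

variable {𝒜 : Type v} {ℬ : Type w} [MeasurableSpace ℬ] {M : Market 𝒜 ℬ} {a : 𝒜} {p : ℝ}

lemma hasStrictFDerivAt_choiceMean_allocLim (hD : M.DemandAssumption)
    (hΩ : M.AllocationAssumption) (hf : M.ChoiceAssumption) {m : ℝ} (hm : 0 < m)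
    (hp : 0 < p * M.allocLim (M.demandMean a / m)) :
    HasStrictFDerivAt
      (fun y : ℝ × ℝ => M.choiceMean a (y.1 * M.allocLim (M.demandMean a / y.2)) - y.2)
      ((M.allocLim (M.demandMean a / m)
            * derivWithin (M.choiceMean a) (Set.Ici 0) (p * M.allocLim (M.demandMean a / m))) •
          ContinuousLinearMap.fst ℝ ℝ ℝ
        - (1 + derivWithin (M.choiceMean a) (Set.Ici 0) (p * M.allocLim (M.demandMean a / m)) * p
            * deriv M.allocLim (M.demandMean a / m) * M.demandMean a / m ^ 2) •
          ContinuousLinearMap.snd ℝ ℝ ℝ) (p, m) := by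
  have hdiv : HasStrictDerivAt (fun m => M.demandMean a / m) (-(M.demandMean a / m ^ 2)) m := by
    simpa [div_eq_mul_inv] using (hasStrictDerivAt_inv hm.ne').const_mul (M.demandMean a)
  have hω : HasStrictDerivAt M.allocLim (deriv M.allocLim (M.demandMean a / m))
      (M.demandMean a / m) :=
    (hΩ.regular.smooth.contDiffAt (Ioi_mem_nhds (div_pos (hD.mean_pos a) hm))).hasStrictDerivAt
      (by simp)
  have hsnd : HasStrictFDerivAt (Prod.snd : ℝ × ℝ → ℝ) (.snd ℝ ℝ ℝ) (p, m) :=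
    hasStrictFDerivAt_snd
  have hreward : HasStrictFDerivAt (fun y : ℝ × ℝ => y.1 * M.allocLim (M.demandMean a / y.2)) _
      (p, m) :=
    hasStrictFDerivAt_fst.mul (HasStrictDerivAt.comp_hasStrictFDerivAt
      (h₂ := fun m => M.allocLim (M.demandMean a / m)) (p, m) (hω.comp m hdiv) hsnd)
  refine (((hf.hasStrictDerivAt_choiceMean a hp).comp_hasStrictFDerivAt (p, m) hreward).sub
    hsnd).congr_fderiv ?_
  ext <;> simp <;> ring

lemma hasDerivAt_meanFieldSupply_of_allocLim_eq_zero (h : ∀ x, 0 ≤ x → M.allocLim x = 0)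
    (hD : M.DemandAssumption) : HasDerivAt (M.meanFieldSupply a) 0 p := by
  have hsol : ∀ p', M.IsMeanFieldSupply a p' = M.IsMeanFieldSupply a p := fun p' => by
    ext ν
    refine and_congr_right fun hν => ?_
    rw [h _ (div_pos (hD.mean_pos a) hν).le, mul_zero, mul_zero]
  have hconst : M.meanFieldSupply a = fun _ => M.meanFieldSupply a p := by
    funext p'
    rw [meanFieldSupply, meanFieldSupply, hsol p']
  rw [hconst]
  exact hasDerivAt_const p _

namespace Viable

lemma hasDerivAt_meanFieldSupply_of_allocLim_pos (hD : M.DemandAssumption)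
    (hΩ : M.AllocationAssumption) (hf : M.ChoiceAssumption) (hp : 0 < p) (hv : M.Viable a p)
    (hω : 0 < M.allocLim (M.demandMean a / M.meanFieldSupply a p)) :
    HasDerivAt (M.meanFieldSupply a) (upsilonHat M.allocLim p (M.demandMean a)
      (M.meanFieldSupply a p) (M.supplyResponse a p)) p := by
  have hspec := hv.isMeanFieldSupply hD hΩ hf hp.le
  have hd := hD.mean_pos a
  have hμ := hspec.1
  have hF := hasStrictFDerivAt_choiceMean_allocLim hD hΩ hf hμ (mul_pos hp hω)
  rw [upsilonHat, supplyResponse]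
  set μ := M.meanFieldSupply a p
  set d := M.demandMean a
  set F' := derivWithin (M.choiceMean a) (Set.Ici 0) (p * M.allocLim (d / μ))
  have hF' : 0 ≤ F' := hf.derivWithin_choiceMean_nonneg a _
  have hω' : 0 ≤ deriv M.allocLim (d / μ) := hΩ.regular.deriv_nonneg (div_pos hd hμ)
  have hpos : 0 < 1 + F' * p * deriv M.allocLim (d / μ) * d / μ ^ 2 := by positivity
  obtain ⟨ψ, hψ, hψμ, hψF⟩ := exists_hasDerivAt_of_hasStrictFDerivAt hF (by
    simpa [-neg_add_rev] using hpos.ne')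
  refine (hψ.congr_of_eventuallyEq ?_).congr_deriv ?_
  · filter_upwards [hψF, hψμ.eventually (lt_mem_nhds hμ), lt_mem_nhds hp] with p' hsol hpos' hp'
    have hsol' : ψ p' = M.choiceMean a (p' * M.allocLim (d / ψ p')) :=
      (sub_eq_zero.1 (hsol.trans (sub_eq_zero.2 hspec.2.2.symm))).symm
    refine IsMeanFieldSupply.meanFieldSupply_eq hD hΩ hf hp'.le ⟨hpos', ?_, hsol'⟩
    rw [hsol']
    exact (hf.choiceMean_mem_Icc a (mul_nonneg hp'.le
      (hΩ.regular.mem_Icc _ (div_pos hd hpos').le).1)).2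
  · have hcancel : p * d * (M.allocLim (d / μ) * F') * deriv M.allocLim (d / μ)
        / (μ ^ 2 * M.allocLim (d / μ)) = F' * p * deriv M.allocLim (d / μ) * d / μ ^ 2 := by
      field_simp
    simp [-neg_add_rev, hcancel, div_neg]

lemma hasDerivAt_meanFieldSupply (hD : M.DemandAssumption) (hΩ : M.AllocationAssumption)
    (hf : M.ChoiceAssumption) (hp : 0 < p) (hv : M.Viable a p) :
    HasDerivAt (M.meanFieldSupply a) (upsilonHat M.allocLim p (M.demandMean a)
      (M.meanFieldSupply a p) (M.supplyResponse a p)) p := by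
  have hx := div_pos (hD.mean_pos a) (hv.isMeanFieldSupply hD hΩ hf hp.le).1
  rcases hΩ.regular.eq_zero_or_pos with hzero | hpos
  · simpa [upsilonHat, supplyResponse, hzero _ hx.le] using
      hasDerivAt_meanFieldSupply_of_allocLim_eq_zero hzero hD
  · exact hv.hasDerivAt_meanFieldSupply_of_allocLim_pos hD hΩ hf hp (hpos _ hx)

lemma hasDerivAt_meanFieldUtility (hD : M.DemandAssumption) (hΩ : M.AllocationAssumption)
    (hf : M.ChoiceAssumption) (hR : M.RevenueAssumption) (hp : 0 < p) (hv : M.Viable a p) :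
    HasDerivAt (M.meanFieldUtility a) (gammaHat M.allocLim M.revenueLim p (M.demandMean a)
      (M.meanFieldSupply a p) (M.supplyResponse a p)) p := by
  have hm := hv.hasDerivAt_meanFieldSupply hD hΩ hf hp
  have hμ := (hv.isMeanFieldSupply hD hΩ hf hp.le).1
  have hx := div_pos (hD.mean_pos a) hμ
  have hquot := (hasDerivAt_const p (M.demandMean a)).fun_div hm hμ.ne'
  have hr := (hasDerivAt_of_contDiffOn_Ioi hR.smooth hx).comp p hquot
  have hω := (hΩ.regular.hasDerivAt hx).comp p hquot
  refine ((hr.sub ((hasDerivAt_id p).mul hω)).mul hm).congr_deriv ?_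
  simp only [Pi.sub_apply, Pi.mul_apply, id, gammaHat, Function.comp_apply]
  field_simp
  ring

end Viable

end Market

/-! ### One period -/

namespace EquilibriumPeriod

variable {𝒜 : Type v} {ℬ : Type w} [MeasurableSpace 𝒜] [MeasurableSpace ℬ]
  {M : Market 𝒜 ℬ} {n : ℕ} {π : Measure ℝ}

/-- The conditional probability given the global state. -/
noncomputable abbrev law (X : EquilibriumPeriod.{u} M n π) (a : 𝒜) : Measure X.Sample :=
  X.Pr[|X.A ⁻¹' {a}]

/-- The expected allocation `E[Ω(D, T) | A = a]` to an active supplier. -/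
noncomputable def expectedAlloc (X : EquilibriumPeriod.{u} M n π) (a : 𝒜) : ℝ :=
  ∫ ω, M.alloc (X.D ω) (∑ j, X.Z j ω) ∂X.law a

section Supply

variable (X : EquilibriumPeriod.{u} M n π)

lemma Z_mem_Icc (i : Fin n) (ω : X.Sample) : X.Z i ω ∈ Set.Icc (0 : ℝ) 1 := by
  rcases X.Z_eq i ω with h | h <;> simp [h]

lemma abs_Z_le_one (i : Fin n) (ω : X.Sample) : |X.Z i ω| ≤ 1 :=
  abs_le.2 ⟨by linarith [(X.Z_mem_Icc i ω).1], (X.Z_mem_Icc i ω).2⟩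

lemma sum_Z_nonneg (ω : X.Sample) : 0 ≤ ∑ j, X.Z j ω :=
  Finset.sum_nonneg fun i _ => (X.Z_mem_Icc i ω).1

lemma sum_Z_le (ω : X.Sample) : ∑ j, X.Z j ω ≤ n :=
  (Finset.sum_le_sum fun i _ => (X.Z_mem_Icc i ω).2).trans_eq (by simp)

lemma natCast_floor_sum_Z (ω : X.Sample) : ((⌊∑ j, X.Z j ω⌋₊ : ℕ) : ℝ) = ∑ j, X.Z j ω := by
  have h : ∀ j, ∃ k : ℕ, X.Z j ω = k := fun j =>
    (X.Z_eq j ω).elim (fun h => ⟨0, by simp [h]⟩) fun h => ⟨1, by simp [h]⟩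
  choose k hk using h
  simp only [hk, ← Nat.cast_sum, Nat.floor_natCast]

lemma measurable_sum_Z : Measurable fun ω => ∑ j, X.Z j ω :=
  Finset.measurable_sum _ fun i _ => X.measurable_Z i

lemma integrable_Z (μ : Measure X.Sample) [IsFiniteMeasure μ] (i : Fin n) :
    Integrable (X.Z i) μ :=
  .of_bound (X.measurable_Z i).aestronglyMeasurable 1 (.of_forall (X.abs_Z_le_one i))

/-- The supply is integer valued, so measurability in the demand is enough. -/
lemma measurable_demand_supply {g : ℝ → ℝ → ℝ} (hg : ∀ t, Measurable fun d => g d t) :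
    Measurable fun ω => g (X.D ω) (∑ j, X.Z j ω) := by
  have h : Measurable fun y : ℝ × ℕ => g y.1 y.2 :=
    measurable_from_prod_countable_left fun k => hg k
  simpa only [Function.comp_def, X.natCast_floor_sum_Z] using
    h.comp (X.measurable_D.prodMk (Nat.measurable_floor.comp X.measurable_sum_Z))

end Supply

section Law

variable (X : EquilibriumPeriod.{u} M n π) {a : 𝒜} [IsProbabilityMeasure (X.law a)]

lemma measure_preimage_A_ne_zero : X.Pr (X.A ⁻¹' {a}) ≠ 0 := fun h =>
  IsProbabilityMeasure.ne_zero (X.law a) (cond_eq_zero_of_meas_eq_zero h)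

lemma measurePreserving_D : MeasurePreserving X.D (X.law a) (M.demandLaw n a) :=
  ⟨X.measurable_D, X.law_D a X.measure_preimage_A_ne_zero⟩

lemma measurePreserving_PB (i : Fin n) :
    MeasurePreserving (fun ω => (X.P i ω, X.B i ω)) (X.law a) (π.prod (M.featureLaw a)) :=
  ⟨(X.measurable_P i).prodMk (X.measurable_B i), X.law_PB a X.measure_preimage_A_ne_zero i⟩

lemma measurePreserving_P (hf : M.ChoiceAssumption) (i : Fin n) :
    MeasurePreserving (X.P i) (X.law a) π :=
  have := hf.isProb a
  measurePreserving_fst.comp (X.measurePreserving_PB i)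

lemma pairwise_indepFun_payment_choice {φ : ℝ × ℝ → ℝ} (hφ : Measurable φ) :
    Pairwise fun j k => IndepFun (fun ω => φ (X.P j ω, X.Z j ω)) (fun ω => φ (X.P k ω, X.Z k ω))
      (X.law a) := fun j k hjk =>
  have hφ' : Measurable fun y : ℝ × ℬ × ℝ => φ (y.1, y.2.2) := by fun_prop
  ((X.indep_suppliers a X.measure_preimage_A_ne_zero).indepFun hjk).comp hφ' hφ'

lemma ae_D_nonneg (hD : M.DemandAssumption) : ∀ᵐ ω ∂X.law a, 0 ≤ X.D ω :=
  X.measurePreserving_D.quasiMeasurePreserving.ae (hD.nonneg n a)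

lemma aestronglyMeasurable_alloc (hD : M.DemandAssumption) (hΩ : M.AllocationAssumption)
    {φ : ℝ → ℝ} (hφ : ∀ t, 0 ≤ t → 0 ≤ φ t) :
    AEStronglyMeasurable (fun ω => M.alloc (X.D ω) (φ (∑ j, X.Z j ω))) (X.law a) := by
  have hmeas : Measurable fun ω => M.alloc (max (X.D ω) 0) (φ (max (∑ j, X.Z j ω) 0)) :=
    X.measurable_demand_supply (g := fun d t => M.alloc (max d 0) (φ (max t 0))) fun t =>
      Monotone.measurable fun d d' hdd' => hΩ.mono_demand _ (hφ _ (le_max_right t 0))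
        (le_max_right d 0) (le_max_right d' 0) (max_le_max_right 0 hdd')
  refine hmeas.aestronglyMeasurable.congr ?_
  filter_upwards [X.ae_D_nonneg hD] with ω hω
  rw [max_eq_left hω, max_eq_left (X.sum_Z_nonneg ω)]

end Law

end EquilibriumPeriod

namespace Market

variable {𝒜 : Type v} {ℬ : Type w} [MeasurableSpace ℬ] {M : Market 𝒜 ℬ}

lemma AllocationAssumption.exists_alloc_mem_Icc (hΩ : M.AllocationAssumption) :
    ∃ C, ∀ d t, 0 ≤ d → 0 ≤ t → M.alloc d t ∈ Set.Icc 0 C := by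
  obtain ⟨C, hC⟩ := hΩ.bounded_zero
  exact ⟨C, fun d t hd ht => ⟨hΩ.nonneg d t hd ht,
    (hΩ.anti_supply d hd Set.self_mem_Ici ht ht).trans (hC d hd)⟩⟩

lemma RevenueAssumption.exists_abs_revenueLim_le (hR : M.RevenueAssumption) :
    ∃ C, 0 ≤ C ∧ ∀ x, 0 ≤ x → |M.revenueLim x| ≤ C * (1 + x) := by
  obtain ⟨C, hC⟩ := hR.deriv_bounded
  have hC0 : 0 ≤ C := (abs_nonneg _).trans (hC 1 one_pos)
  refine ⟨|M.revenueLim 0| + |M.revenueLim 1| + C, by positivity, fun x hx => ?_⟩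
  have h0 := abs_nonneg (M.revenueLim 0)
  have h1 := abs_nonneg (M.revenueLim 1)
  rcases hx.eq_or_lt with rfl | hx
  · linarith
  have hlip : |M.revenueLim x - M.revenueLim 1| ≤ C * |x - 1| :=
    (convex_Ioi (0 : ℝ)).norm_image_sub_le_of_norm_deriv_le
      (fun y hy => (hasDerivAt_of_contDiffOn_Ioi hR.smooth hy).differentiableAt) hC
      (Set.mem_Ioi.2 one_pos) hx
  have hx1 : |x - 1| ≤ 1 + x := abs_le.2 ⟨by linarith, by linarith⟩
  calc |M.revenueLim x| ≤ |M.revenueLim 1| + |M.revenueLim x - M.revenueLim 1| := by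
        simpa using abs_add_le (M.revenueLim 1) (M.revenueLim x - M.revenueLim 1)
    _ ≤ |M.revenueLim 1| + C * (1 + x) := by
        gcongr
        exact hlip.trans (by gcongr)
    _ ≤ (|M.revenueLim 0| + |M.revenueLim 1| + C) * (1 + x) := by
        linarith [mul_nonneg h0 hx.le, mul_nonneg h1 hx.le]

lemma RevenueAssumption.exists_abs_revenue_le (hR : M.RevenueAssumption) :
    ∃ C, 0 ≤ C ∧ ∀ d t, 0 ≤ d → 0 ≤ t → |M.revenue d t| ≤ C * (d + t) := by
  obtain ⟨C, hC0, hC⟩ := hR.exists_abs_revenueLim_le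
  obtain ⟨l, hl, happrox⟩ := hR.approx
  obtain ⟨C', hC'⟩ := hl.bounded
  have hC'0 : 0 ≤ C' := (abs_nonneg _).trans (hC' 0 0 le_rfl le_rfl)
  refine ⟨C + C', by positivity, fun d t hd ht => ?_⟩
  rcases ht.eq_or_lt with rfl | ht
  · rw [hR.zero_supply d hd, abs_zero]
    positivity
  calc |M.revenue d t| = |M.revenueLim (d / t) - l d t| * t := by
        rw [happrox d t hd ht, abs_mul, abs_of_pos ht]
    _ ≤ (C * (1 + d / t) + C') * t := by
        gcongr
        exact (abs_sub _ _).trans (add_le_add (hC _ (div_nonneg hd ht.le)) (hC' d t hd ht.le))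
    _ = C * d + (C + C') * t := by field_simp; ring
    _ ≤ (C + C') * (d + t) := by linarith [mul_nonneg hC'0 hd]

end Market

namespace EquilibriumPeriod

variable {𝒜 : Type v} {ℬ : Type w} [MeasurableSpace 𝒜] [MeasurableSpace ℬ]
  {M : Market 𝒜 ℬ} {n : ℕ} {π : Measure ℝ} (X : EquilibriumPeriod.{u} M n π) {a : 𝒜}
  [IsProbabilityMeasure (X.law a)]

lemma integrable_alloc (hD : M.DemandAssumption) (hΩ : M.AllocationAssumption) {φ : ℝ → ℝ}
    (hφ : ∀ t, 0 ≤ t → 0 ≤ φ t) :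
    Integrable (fun ω => M.alloc (X.D ω) (φ (∑ j, X.Z j ω))) (X.law a) := by
  obtain ⟨C, hC⟩ := hΩ.exists_alloc_mem_Icc
  refine .of_mem_Icc 0 C (X.aestronglyMeasurable_alloc hD hΩ hφ).aemeasurable ?_
  filter_upwards [X.ae_D_nonneg hD] with ω hω
  exact hC _ _ hω (hφ _ (X.sum_Z_nonneg ω))

lemma expectedAlloc_mem_Icc (hD : M.DemandAssumption) (hΩ : M.AllocationAssumption) {C : ℝ}
    (hC : ∀ d t, 0 ≤ d → 0 ≤ t → M.alloc d t ∈ Set.Icc 0 C) :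
    X.expectedAlloc a ∈ Set.Icc 0 C := by
  have hmem : ∀ᵐ ω ∂X.law a, M.alloc (X.D ω) (∑ j, X.Z j ω) ∈ Set.Icc 0 C := by
    filter_upwards [X.ae_D_nonneg hD] with ω hω
    exact hC _ _ hω (X.sum_Z_nonneg ω)
  refine ⟨integral_nonneg_of_ae (hmem.mono fun _ h => h.1), ?_⟩
  exact (integral_mono_ae (X.integrable_alloc hD hΩ fun _ h => h) (integrable_const C)
    (hmem.mono fun _ h => h.2)).trans_eq (by simp)

lemma expectedAlloc_nonneg (hD : M.DemandAssumption) (hΩ : M.AllocationAssumption) :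
    0 ≤ X.expectedAlloc a :=
  have ⟨_, hC⟩ := hΩ.exists_alloc_mem_Icc
  (X.expectedAlloc_mem_Icc hD hΩ hC).1

lemma integrable_revenue (hD : M.DemandAssumption) (hR : M.RevenueAssumption) :
    Integrable (fun ω => M.revenue (X.D ω) (∑ j, X.Z j ω)) (X.law a) := by
  obtain ⟨C, hC0, hC⟩ := hR.exists_abs_revenue_le
  have hDint : Integrable X.D (X.law a) :=
    X.measurePreserving_D.integrable_comp_of_integrable (hD.integrable n a)
  refine ((hDint.add (integrable_const (n : ℝ))).const_mul C).mono'
    (X.measurable_demand_supply hR.measurable).aestronglyMeasurable ?_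
  filter_upwards [X.ae_D_nonneg hD] with ω hω
  exact (hC _ _ hω (X.sum_Z_nonneg ω)).trans
    (mul_le_mul_of_nonneg_left (add_le_add_right (X.sum_Z_le ω) _) hC0)

lemma integral_Z_mul_eq_integral_choice (hf : M.ChoiceAssumption) {g : ℝ → ℝ} (hg : Measurable g)
    (hgπ : Integrable g π) (i : Fin n) :
    ∫ ω, X.Z i ω * g (X.P i ω) ∂X.law a
      = ∫ ω, M.choice (X.B i ω) (X.P i ω * X.expectedAlloc a) * g (X.P i ω) ∂X.law a := by
  have hPB := (X.measurable_P i).prodMk (X.measurable_B i)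
  have hgP : StronglyMeasurable[.comap (fun ω => (X.P i ω, X.B i ω)) inferInstance]
      fun ω => g (X.P i ω) :=
    ((hg.comp measurable_fst).comp (comap_measurable _)).stronglyMeasurable
  have hgPint : Integrable (fun ω => g (X.P i ω)) (X.law a) :=
    (X.measurePreserving_P hf i).integrable_comp_of_integrable hgπ
  have hZg : Integrable (X.Z i * fun ω => g (X.P i ω)) (X.law a) :=
    hgPint.bdd_mul (X.measurable_Z i).aestronglyMeasurable (.of_forall (X.abs_Z_le_one i))
  calc ∫ ω, X.Z i ω * g (X.P i ω) ∂X.law a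
      = ∫ ω, ((X.law a)[X.Z i * fun ω => g (X.P i ω) |
          .comap (fun ω => (X.P i ω, X.B i ω)) inferInstance]) ω ∂X.law a :=
        (integral_condExp hPB.comap_le).symm
    _ = ∫ ω, M.choice (X.B i ω) (X.P i ω * X.expectedAlloc a) * g (X.P i ω) ∂X.law a :=
        integral_congr_ae <| by
          filter_upwards [condExp_mul_of_stronglyMeasurable_right hgP hZg (X.integrable_Z _ i),
            X.choice_eq a X.measure_preimage_A_ne_zero i] with ω hpull hchoice
          rw [hpull, Pi.mul_apply, hchoice]
          rfl

lemma integral_Z_mul [SFinite π] (hD : M.DemandAssumption) (hΩ : M.AllocationAssumption)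
    (hf : M.ChoiceAssumption) (hπ : ∀ᵐ x ∂π, 0 ≤ x) {g : ℝ → ℝ} (hg : Measurable g)
    (hgπ : Integrable g π) (i : Fin n) :
    ∫ ω, X.Z i ω * g (X.P i ω) ∂X.law a
      = ∫ x, M.choiceMean a (x * X.expectedAlloc a) * g x ∂π := by
  have hβ := hf.isProb a
  have hq := X.expectedAlloc_nonneg hD hΩ (a := a)
  have hPB := X.measurePreserving_PB i (a := a)
  let h : ℝ × ℬ → ℝ := fun y => M.choice y.2 (max (y.1 * X.expectedAlloc a) 0) * g y.1
  have hh : Measurable h := (hf.measurable_choice.comp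
    (f := fun y : ℝ × ℬ => (y.1 * X.expectedAlloc a, y.2)) (by fun_prop)).mul
      (hg.comp measurable_fst)
  have hhint : Integrable h (π.prod (M.featureLaw a)) :=
    (hgπ.comp_fst _).mono hh.aestronglyMeasurable (.of_forall fun y => by
      have hchoice := hf.mem_Icc y.2 _ (le_max_right (y.1 * X.expectedAlloc a) 0)
      rw [norm_mul, Real.norm_of_nonneg hchoice.1]
      exact mul_le_of_le_one_left (norm_nonneg _) hchoice.2)
  calc ∫ ω, X.Z i ω * g (X.P i ω) ∂X.law a
      = ∫ ω, h (X.P i ω, X.B i ω) ∂X.law a := by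
        rw [X.integral_Z_mul_eq_integral_choice hf hg hgπ i]
        refine integral_congr_ae ?_
        filter_upwards [(X.measurePreserving_P hf i).quasiMeasurePreserving.ae hπ] with ω hω
        simp only [h, max_eq_left (mul_nonneg hω hq)]
    _ = ∫ y, h y ∂π.prod (M.featureLaw a) := by
        rw [← hPB.map_eq, integral_map hPB.aemeasurable hh.aestronglyMeasurable]
    _ = ∫ x, M.choiceMean a (x * X.expectedAlloc a) * g x ∂π := by
        rw [integral_prod h hhint]
        refine integral_congr_ae ?_
        filter_upwards [hπ] with x hx
        simp only [h, integral_mul_const, max_eq_left (mul_nonneg hx hq), Market.choiceMean]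

end EquilibriumPeriod

section PerturbedPayment

variable {p z : ℝ}

instance : IsProbabilityMeasure (perturbedPayment p z) :=
  ⟨by simp [perturbedPayment, ENNReal.inv_two_add_inv_two]⟩

lemma ae_perturbedPayment_iff {q : ℝ → Prop} :
    (∀ᵐ x ∂perturbedPayment p z, q x) ↔ q (p + z) ∧ q (p - z) := by
  simp [perturbedPayment, ae_add_measure_iff]

lemma integrable_perturbedPayment (g : ℝ → ℝ) : Integrable g (perturbedPayment p z) :=
  ((integrable_dirac enorm_lt_top).smul_measure (by simp)).add_measure
    ((integrable_dirac enorm_lt_top).smul_measure (by simp))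

lemma integral_perturbedPayment (g : ℝ → ℝ) :
    ∫ x, g x ∂perturbedPayment p z = (g (p + z) + g (p - z)) / 2 := by
  rw [perturbedPayment, integral_add_measure
    ((integrable_dirac enorm_lt_top).smul_measure (by simp))
    ((integrable_dirac enorm_lt_top).smul_measure (by simp))]
  simp only [integral_smul_measure, integral_dirac, ENNReal.toReal_inv, ENNReal.toReal_ofNat,
    smul_eq_mul]
  ring

end PerturbedPayment

/-- The conditional mean of the platform's utility given the demand `d` and the supply `t`, when
every payment equals `p`. -/
noncomputable def Market.profit {𝒜 ℬ : Type*} [MeasurableSpace ℬ] (M : Market 𝒜 ℬ)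
    (p d t : ℝ) : ℝ :=
  M.revenue d t - p * t * M.alloc d t

namespace EquilibriumPeriod

variable {𝒜 : Type v} {ℬ : Type w} [MeasurableSpace 𝒜] [MeasurableSingletonClass 𝒜]
  [MeasurableSpace ℬ] {M : Market 𝒜 ℬ} {n : ℕ} {a : 𝒜}

section Served

variable {π : Measure ℝ} (X : EquilibriumPeriod.{u} M n π)

lemma integrable_Z_mul_S_and_integral_eq (i : Fin n) :
    Integrable (fun ω => X.Z i ω * X.S i ω) (X.law a) ∧
    ∫ ω, X.Z i ω * X.S i ω ∂X.law a
      = ∫ ω, X.Z i ω * M.alloc (X.D ω) (∑ j, X.Z j ω) ∂X.law a := by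
  have hA : MeasurableSet (X.A ⁻¹' {a}) := X.measurable_A (measurableSet_singleton a)
  set active := X.Z i ⁻¹' {1} with hactive
  have hs : MeasurableSet active := X.measurable_Z i (measurableSet_singleton 1)
  have hind : ∀ f : X.Sample → ℝ, (fun ω => X.Z i ω * f ω) = active.indicator f := fun f => by
    funext ω
    rcases X.Z_eq i ω with h | h <;> simp [hactive, h]
  rw [hind, hind, integrable_indicator_iff hs, integral_indicator hs, integral_indicator hs]
  rcases eq_or_ne (X.law a active) 0 with h0 | h0
  · simp [IntegrableOn, Measure.restrict_eq_zero.2 h0]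
  have : IsProbabilityMeasure ((X.law a)[|active]) := cond_isProbabilityMeasure h0
  have hserved := X.integrable_S a i
  have halloc := X.alloc_eq a i
  rw [← cond_cond_eq_cond_inter hA hs] at hserved halloc
  have hDT : Measurable fun ω => (X.D ω, ∑ j, X.Z j ω) :=
    X.measurable_D.prodMk X.measurable_sum_Z
  have hc0 : (X.law a active)⁻¹ ≠ 0 := ENNReal.inv_ne_zero.2 (measure_ne_top _ _)
  have hct : (X.law a active)⁻¹ ≠ ⊤ := ENNReal.inv_ne_top.2 h0
  refine ⟨(integrable_smul_measure hc0 hct).1 hserved, ?_⟩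
  have heq : ∫ ω, X.S i ω ∂(X.law a)[|active]
      = ∫ ω, M.alloc (X.D ω) (∑ j, X.Z j ω) ∂(X.law a)[|active] :=
    (integral_condExp hDT.comap_le).symm.trans (integral_congr_ae halloc)
  rw [ProbabilityTheory.cond, integral_smul_measure, integral_smul_measure] at heq
  exact smul_right_injective ℝ (ENNReal.toReal_ne_zero.2 ⟨hc0, hct⟩) heq

end Served

lemma utility_dirac {p : ℝ} (X : EquilibriumPeriod.{u} M n (.dirac p))
    [IsProbabilityMeasure (X.law a)] (hD : M.DemandAssumption) (hΩ : M.AllocationAssumption)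
    (hf : M.ChoiceAssumption) (hR : M.RevenueAssumption) :
    X.utility a = ∫ ω, M.profit p (X.D ω) (∑ j, X.Z j ω) / n ∂X.law a := by
  have hP : ∀ᵐ ω ∂X.law a, ∀ i, X.P i ω = p := ae_all_iff.2 fun i =>
    (X.measurePreserving_P hf i).quasiMeasurePreserving.ae (p := (· = p)) (by simp)
  have hrev := X.integrable_revenue hD hR (a := a)
  have hZS : ∀ i, Integrable (fun ω => p * (X.Z i ω * X.S i ω)) (X.law a) := fun i =>
    (X.integrable_Z_mul_S_and_integral_eq i).1.const_mul p
  have hZΩ : ∀ i, Integrable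
      (fun ω => p * (X.Z i ω * M.alloc (X.D ω) (∑ j, X.Z j ω))) (X.law a) := fun i =>
    ((X.integrable_alloc hD hΩ fun _ h => h).bdd_mul (X.measurable_Z i).aestronglyMeasurable
      (.of_forall (X.abs_Z_le_one i))).const_mul p
  have hserved : ∫ ω, (M.revenue (X.D ω) (∑ j, X.Z j ω) - ∑ i, X.P i ω * X.Z i ω * X.S i ω)
      ∂X.law a = ∫ ω, (M.revenue (X.D ω) (∑ j, X.Z j ω) - ∑ i, p * (X.Z i ω * X.S i ω))
      ∂X.law a := integral_congr_ae <| by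
    filter_upwards [hP] with ω hω
    simp only [hω, mul_assoc]
  have hpaid : ∀ ω, p * (∑ j, X.Z j ω) * M.alloc (X.D ω) (∑ j, X.Z j ω)
      = ∑ i, p * (X.Z i ω * M.alloc (X.D ω) (∑ j, X.Z j ω)) := fun ω => by
    rw [mul_assoc, Finset.sum_mul, Finset.mul_sum]
  simp only [Market.profit, hpaid]
  rw [utility, hserved, integral_div, one_div, inv_mul_eq_div,
    integral_sub hrev (integrable_finsetSum _ fun i _ => hZS i),
    integral_sub hrev (integrable_finsetSum _ fun i _ => hZΩ i),
    integral_finsetSum _ fun i _ => hZS i, integral_finsetSum _ fun i _ => hZΩ i]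
  simp only [integral_const_mul, (X.integrable_Z_mul_S_and_integral_eq _).2]

end EquilibriumPeriod

/-! ### Large markets -/

lemma IsErrorFunction.tendsto {l : ℝ → ℝ → ℝ} (hl : IsErrorFunction l) :
    Tendsto (fun x : ℝ × ℝ => l x.1 x.2) (atTop ×ˢ atTop) (𝓝 0) := by
  have hsqrt : Tendsto (fun y : ℝ => 1 / √y) atTop (𝓝 0) := by
    simpa [Function.comp_def] using tendsto_inv_atTop_zero.comp Real.tendsto_sqrt_atTop
  refine hl.isLittleO.trans_tendsto ?_
  simpa using (hsqrt.comp tendsto_snd).add (hsqrt.comp tendsto_fst)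

lemma tendsto_atTop_of_tendsto_div {ι : Type*} {l : Filter ι} {N D : ι → ℝ}
    (hN : Tendsto N l atTop) {d : ℝ} (hd : 0 < d) (hD : Tendsto (fun i => D i / N i) l (𝓝 d)) :
    Tendsto D l atTop :=
  (hD.pos_mul_atTop hd hN).congr' <| (hN.eventually_ne_atTop 0).mono fun _ h => div_mul_cancel₀ _ h

namespace Market

variable {𝒜 ℬ : Type*} [MeasurableSpace ℬ] {M : Market 𝒜 ℬ} {ι : Type*} {l : Filter ι}
  {N D T : ι → ℝ} {d t : ℝ}

lemma AllocationAssumption.tendsto_alloc (hΩ : M.AllocationAssumption) (hN : Tendsto N l atTop)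
    (hd : 0 < d) (ht : 0 < t) (hD : Tendsto (fun i => D i / N i) l (𝓝 d))
    (hT : Tendsto (fun i => T i / N i) l (𝓝 t)) :
    Tendsto (fun i => M.alloc (D i) (T i)) l (𝓝 (M.allocLim (d / t))) := by
  obtain ⟨err, herr, happrox⟩ := hΩ.approx
  have hDtop := tendsto_atTop_of_tendsto_div hN hd hD
  have hTtop := tendsto_atTop_of_tendsto_div hN ht hT
  have hω : Tendsto (fun i => M.allocLim (D i / N i / (T i / N i))) l (𝓝 (M.allocLim (d / t))) :=
    (hΩ.regular.hasDerivAt (div_pos hd ht)).continuousAt.tendsto.comp (hD.div hT ht.ne')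
  have hsum := hω.add (herr.tendsto.comp (hDtop.prodMk hTtop))
  rw [add_zero] at hsum
  refine hsum.congr' ?_
  filter_upwards [hN.eventually_ne_atTop 0, hDtop.eventually_ge_atTop 0,
    hTtop.eventually_gt_atTop 0] with i hNi hDi hTi
  rw [happrox _ _ hDi hTi, div_div_div_cancel_right₀ hNi, Function.comp_apply]

lemma RevenueAssumption.tendsto_revenue_div (hR : M.RevenueAssumption) (hN : Tendsto N l atTop)
    (hd : 0 < d) (ht : 0 < t) (hD : Tendsto (fun i => D i / N i) l (𝓝 d))
    (hT : Tendsto (fun i => T i / N i) l (𝓝 t)) :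
    Tendsto (fun i => M.revenue (D i) (T i) / N i) l (𝓝 (M.revenueLim (d / t) * t)) := by
  obtain ⟨err, herr, happrox⟩ := hR.approx
  have hDtop := tendsto_atTop_of_tendsto_div hN hd hD
  have hTtop := tendsto_atTop_of_tendsto_div hN ht hT
  have hr : Tendsto (fun i => M.revenueLim (D i / N i / (T i / N i))) l
      (𝓝 (M.revenueLim (d / t))) :=
    (hasDerivAt_of_contDiffOn_Ioi hR.smooth (div_pos hd ht)).continuousAt.tendsto.comp
      (hD.div hT ht.ne')
  have hprod := (hr.sub (herr.tendsto.comp (hDtop.prodMk hTtop))).mul hT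
  rw [sub_zero] at hprod
  refine hprod.congr' ?_
  filter_upwards [hN.eventually_ne_atTop 0, hDtop.eventually_ge_atTop 0,
    hTtop.eventually_gt_atTop 0] with i hNi hDi hTi
  rw [happrox _ _ hDi hTi, div_div_div_cancel_right₀ hNi, Function.comp_apply, mul_div_assoc]

lemma ChoiceAssumption.tendsto_integral_choiceMean_mul {π : ι → Measure ℝ} {a : 𝒜} {p : ℝ}
    (hf : M.ChoiceAssumption) [∀ i, IsProbabilityMeasure (π i)]
    (hπ0 : ∀ i, ∀ᵐ x ∂π i, 0 ≤ x)
    (hπ : Tendsto (fun x : Σ _ : ι, ℝ => x.2) (withHighProb l π) (𝓝 p)) {q : ι → ℝ}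
    (hq0 : ∀ i, 0 ≤ q i) {q₀ : ℝ} (hq : Tendsto q l (𝓝 q₀)) (hp : 0 ≤ p * q₀) :
    Tendsto (fun i => ∫ x, M.choiceMean a (x * q i) ∂π i) l (𝓝 (M.choiceMean a (p * q₀))) := by
  have hnonneg : ∀ i, ∀ᵐ x ∂π i, 0 ≤ x * q i := fun i =>
    (hπ0 i).mono fun x hx => mul_nonneg hx (hq0 i)
  refine tendsto_integral_of_withHighProb_of_bounded (C := 1)
    (Y := fun x : Σ _ : ι, ℝ => M.choiceMean a (x.2 * q x.1)) (fun i => ?_) (fun i => ?_) ?_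
  · have hmono : Monotone fun x => M.choiceMean a (max x 0) := fun x y hxy =>
      hf.monotoneOn_choiceMean a (le_max_right x 0) (le_max_right y 0) (max_le_max_right 0 hxy)
    refine (hmono.measurable.comp (measurable_id.mul_const (q i))).aestronglyMeasurable.congr ?_
    filter_upwards [hnonneg i] with x hx
    simp only [Function.comp_apply, id, max_eq_left hx]
  · filter_upwards [hnonneg i] with x hx
    have hmem := hf.choiceMean_mem_Icc a hx
    exact (abs_of_nonneg hmem.1).trans_le hmem.2
  · exact (hf.continuousOn_choiceMean a _ hp).tendsto.comp <| tendsto_nhdsWithin_iff.2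
      ⟨hπ.mul (hq.comp tendsto_fst_withHighProb),
        eventually_withHighProb_of_ae (.of_forall hnonneg)⟩

end Market

namespace EquilibriumPeriod

variable {𝒜 : Type v} {ℬ : Type w} [MeasurableSpace 𝒜] [MeasurableSpace ℬ]
  {M : Market 𝒜 ℬ} {ι : Type*} {l : Filter ι} {N : ι → ℕ} {π : ι → Measure ℝ}
  (X : ∀ i, EquilibriumPeriod.{u} M (N i) (π i)) {a : 𝒜} [∀ i, IsProbabilityMeasure ((X i).law a)]
  {p : ℝ}

lemma tendsto_lintegral_demand (hN : Tendsto N l atTop) (hD : M.DemandAssumption) :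
    Tendsto (fun i => ∫⁻ ω, ENNReal.ofReal (((X i).D ω / N i - M.demandMean a) ^ 2) ∂(X i).law a)
      l (𝓝 0) :=
  ((hD.concentrates a).comp hN).congr fun i =>
    ((X i).measurePreserving_D.lintegral_comp (by fun_prop)).symm

lemma tendsto_demand (hN : Tendsto N l atTop) (hD : M.DemandAssumption) :
    Tendsto (fun x : Σ i, (X i).Sample => (X x.1).D x.2 / N x.1)
      (withHighProb l fun i => (X i).law a) (𝓝 (M.demandMean a)) :=
  tendsto_withHighProb_of_meanSquare
    (fun i => ((X i).measurable_D.div_const (N i : ℝ)).aemeasurable)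
    (tendsto_lintegral_demand X hN hD)

lemma tendsto_integral_alloc (hN : Tendsto N l atTop) (hD : M.DemandAssumption)
    (hΩ : M.AllocationAssumption) {φ : ι → ℝ → ℝ} (hφ : ∀ i t, 0 ≤ t → 0 ≤ φ i t) {s : ℝ}
    (hs : 0 < s)
    (hT : Tendsto (fun x : Σ i, (X i).Sample => φ x.1 (∑ j, (X x.1).Z j x.2) / N x.1)
      (withHighProb l fun i => (X i).law a) (𝓝 s)) :
    Tendsto (fun i => ∫ ω, M.alloc ((X i).D ω) (φ i (∑ j, (X i).Z j ω)) ∂(X i).law a) l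
      (𝓝 (M.allocLim (M.demandMean a / s))) := by
  obtain ⟨C, hC⟩ := hΩ.exists_alloc_mem_Icc
  refine tendsto_integral_of_withHighProb_of_bounded (C := C)
    (fun i => (X i).aestronglyMeasurable_alloc hD hΩ (hφ i)) (fun i => ?_)
    (hΩ.tendsto_alloc (tendsto_natCast_atTop_atTop.comp (hN.comp tendsto_fst_withHighProb))
      (hD.mean_pos a) hs (tendsto_demand X hN hD) hT)
  filter_upwards [(X i).ae_D_nonneg hD] with ω hω
  have hmem := hC _ _ hω (hφ i _ ((X i).sum_Z_nonneg ω))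
  exact (abs_of_nonneg hmem.1).trans_le hmem.2

/-- Given the anticipated allocation the decisions are independent, so the law of large numbers
applies. -/
lemma tendsto_supply_of_tendsto_expectedAlloc (hN : Tendsto N l atTop) (hD : M.DemandAssumption)
    (hΩ : M.AllocationAssumption) (hf : M.ChoiceAssumption) [∀ i, IsProbabilityMeasure (π i)]
    (hπ0 : ∀ i, ∀ᵐ x ∂π i, 0 ≤ x)
    (hπ : Tendsto (fun x : Σ _ : ι, ℝ => x.2) (withHighProb l π) (𝓝 p)) {q₀ : ℝ}
    (hq : Tendsto (fun i => (X i).expectedAlloc a) l (𝓝 q₀)) (hp : 0 ≤ p * q₀) :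
    Tendsto (fun x : Σ i, (X i).Sample => sampleMean fun k => (X x.1).Z k x.2)
      (withHighProb l fun i => (X i).law a) (𝓝 (M.choiceMean a (p * q₀))) := by
  have hm := hf.tendsto_integral_choiceMean_mul (a := a) hπ0 hπ
    (fun i => (X i).expectedAlloc_nonneg hD hΩ) hq hp
  have hlln := tendsto_sampleMean_div (c := fun _ => 1) (P := fun i => (X i).law a)
    (W := fun i => (X i).Z) (y := M.choiceMean a (p * q₀))
    (by simpa [Function.comp_def] using tendsto_natCast_atTop_atTop.comp hN)
    (fun i k => ((X i).measurable_Z k).aemeasurable)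
    (fun i => (X i).pairwise_indepFun_payment_choice measurable_snd)
    (fun i k => .of_forall fun ω => abs_le.1 ((X i).abs_Z_le_one k ω))
    (fun i k => by
      simpa using (X i).integral_Z_mul hD hΩ hf (hπ0 i) measurable_one (integrable_const 1) k)
    (by simpa using hm)
  simpa using hlln

end EquilibriumPeriod

namespace EquilibriumPeriod

variable {𝒜 : Type v} {ℬ : Type w} [MeasurableSpace 𝒜] [MeasurableSpace ℬ]
  {M : Market 𝒜 ℬ} {ι : Type*} {l : Filter ι} {N : ι → ℕ} {π : ι → Measure ℝ}
  (X : ∀ i, EquilibriumPeriod.{u} M (N i) (π i)) {a : 𝒜} [∀ i, IsProbabilityMeasure ((X i).law a)]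
  {p : ℝ} [∀ i, IsProbabilityMeasure (π i)]

/-- With a vanishing supply the allocation would exceed the one at a small positive supply, for
which suppliers do become active. -/
lemma choiceMean_pos_of_tendsto_expectedAlloc [l.NeBot] (hN : Tendsto N l atTop)
    (hD : M.DemandAssumption) (hΩ : M.AllocationAssumption) (hf : M.ChoiceAssumption)
    (hπ0 : ∀ i, ∀ᵐ x ∂π i, 0 ≤ x)
    (hπ : Tendsto (fun x : Σ _ : ι, ℝ => x.2) (withHighProb l π) (𝓝 p)) (hp : 0 ≤ p)
    (hv : M.Viable a p) {q₀ : ℝ}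
    (hq : Tendsto (fun i => (X i).expectedAlloc a) l (𝓝 q₀)) :
    0 < M.choiceMean a (p * q₀) := by
  have hq₀ : 0 ≤ q₀ := ge_of_tendsto' hq fun i => (X i).expectedAlloc_nonneg hD hΩ
  refine ((hf.choiceMean_mem_Icc a (mul_nonneg hp hq₀)).1).lt_of_ne' fun hzero => ?_
  obtain ⟨x, hx, hpos⟩ := hv
  have ht := div_pos (hD.mean_pos a) hx
  set t := M.demandMean a / x
  have hsupply := tendsto_supply_of_tendsto_expectedAlloc X hN hD hΩ hf hπ0 hπ hq
    (mul_nonneg hp hq₀)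
  rw [hzero] at hsupply
  have hmax : Tendsto (fun y : Σ i, (X i).Sample =>
      max (∑ j, (X y.1).Z j y.2) (t * N y.1) / N y.1) (withHighProb l fun i => (X i).law a)
      (𝓝 t) := by
    have h := hsupply.max (tendsto_const_nhds (x := t))
    rw [max_eq_right ht.le] at h
    refine h.congr' ?_
    filter_upwards [(hN.comp tendsto_fst_withHighProb).eventually_gt_atTop 0] with y hy
    have hy : (0 : ℝ) < N y.1 := Nat.cast_pos.2 hy
    rw [← max_div_div_right hy.le, mul_div_cancel_right₀ _ hy.ne', sampleMean]
  have halloc := tendsto_integral_alloc X hN hD hΩ (φ := fun i s => max s (t * N i))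
    (fun _ _ h => h.trans (le_max_left _ _)) ht hmax
  rw [div_div_cancel₀ (hD.mean_pos a).ne'] at halloc
  have hle : M.allocLim x ≤ q₀ := le_of_tendsto_of_tendsto' halloc hq fun i => by
    refine integral_mono_ae ((X i).integrable_alloc hD hΩ fun _ h => h.trans (le_max_left _ _))
      ((X i).integrable_alloc hD hΩ fun _ h => h) ?_
    filter_upwards [(X i).ae_D_nonneg hD] with ω hω
    have hsum := (X i).sum_Z_nonneg ω
    exact hΩ.anti_supply _ hω hsum (hsum.trans (le_max_left _ _)) (le_max_left _ _)
  have hωx := mul_nonneg hp (hΩ.regular.mem_Icc x hx.le).1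
  exact hpos.not_ge <| hzero ▸ hf.monotoneOn_choiceMean a hωx (mul_nonneg hp hq₀)
    (mul_le_mul_of_nonneg_left hle hp)

lemma eq_allocLim_of_tendsto_expectedAlloc [l.NeBot] (hN : Tendsto N l atTop)
    (hD : M.DemandAssumption) (hΩ : M.AllocationAssumption) (hf : M.ChoiceAssumption)
    (hπ0 : ∀ i, ∀ᵐ x ∂π i, 0 ≤ x)
    (hπ : Tendsto (fun x : Σ _ : ι, ℝ => x.2) (withHighProb l π) (𝓝 p)) (hp : 0 ≤ p)
    (hv : M.Viable a p) {q₀ : ℝ}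
    (hq : Tendsto (fun i => (X i).expectedAlloc a) l (𝓝 q₀)) :
    q₀ = M.allocLim (M.demandMean a / M.meanFieldSupply a p) := by
  have hpq₀ : 0 ≤ p * q₀ :=
    mul_nonneg hp (ge_of_tendsto' hq fun i => (X i).expectedAlloc_nonneg hD hΩ)
  have hpos := choiceMean_pos_of_tendsto_expectedAlloc X hN hD hΩ hf hπ0 hπ hp hv hq
  have hq₀ : q₀ = M.allocLim (M.demandMean a / M.choiceMean a (p * q₀)) :=
    tendsto_nhds_unique hq <| tendsto_integral_alloc X hN hD hΩ (φ := fun _ t => t)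
      (fun _ _ h => h) hpos
      (tendsto_supply_of_tendsto_expectedAlloc X hN hD hΩ hf hπ0 hπ hq hpq₀)
  have hsupply : M.IsMeanFieldSupply a p (M.choiceMean a (p * q₀)) :=
    ⟨hpos, (hf.choiceMean_mem_Icc a hpq₀).2, by rw [← hq₀, Market.choiceMean]⟩
  rw [hsupply.meanFieldSupply_eq hD hΩ hf hp, ← hq₀]

/-- By compactness it is enough that the limit is determined, which it is by the uniqueness of the
solution of the balance equation. -/
lemma tendsto_expectedAlloc (hN : Tendsto N l atTop) (hD : M.DemandAssumption)
    (hΩ : M.AllocationAssumption) (hf : M.ChoiceAssumption) (hπ0 : ∀ i, ∀ᵐ x ∂π i, 0 ≤ x)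
    (hπ : Tendsto (fun x : Σ _ : ι, ℝ => x.2) (withHighProb l π) (𝓝 p)) (hp : 0 ≤ p)
    (hv : M.Viable a p) :
    Tendsto (fun i => (X i).expectedAlloc a) l
      (𝓝 (M.allocLim (M.demandMean a / M.meanFieldSupply a p))) := by
  obtain ⟨C, hC⟩ := hΩ.exists_alloc_mem_Icc
  refine tendsto_iff_ultrafilter _ _ _ |>.2 fun g hg => ?_
  obtain ⟨q₀, -, hq₀⟩ := isCompact_Icc.ultrafilter_le_nhds
    (g.map fun i => (X i).expectedAlloc a) <| le_principal_iff.2 <| Ultrafilter.mem_map.2 <|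
    Filter.univ_mem' fun i => (X i).expectedAlloc_mem_Icc hD hΩ hC
  rw [← eq_allocLim_of_tendsto_expectedAlloc X (hN.mono_left hg) hD hΩ hf hπ0
    (hπ.mono_left (withHighProb_mono hg)) hp hv hq₀]
  exact hq₀

lemma tendsto_supply (hN : Tendsto N l atTop) (hD : M.DemandAssumption)
    (hΩ : M.AllocationAssumption) (hf : M.ChoiceAssumption) (hπ0 : ∀ i, ∀ᵐ x ∂π i, 0 ≤ x)
    (hπ : Tendsto (fun x : Σ _ : ι, ℝ => x.2) (withHighProb l π) (𝓝 p)) (hp : 0 ≤ p)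
    (hv : M.Viable a p) :
    Tendsto (fun x : Σ i, (X i).Sample => sampleMean fun k => (X x.1).Z k x.2)
      (withHighProb l fun i => (X i).law a) (𝓝 (M.meanFieldSupply a p)) := by
  have hμ := hv.isMeanFieldSupply hD hΩ hf hp
  have hω := (hΩ.regular.mem_Icc _ (div_pos (hD.mean_pos a) hμ.1).le).1
  have h := tendsto_supply_of_tendsto_expectedAlloc X hN hD hΩ hf hπ0 hπ
    (tendsto_expectedAlloc X hN hD hΩ hf hπ0 hπ hp hv) (mul_nonneg hp hω)
  rwa [Market.choiceMean, ← hμ.2.2] at h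

end EquilibriumPeriod

section Utility

open EquilibriumPeriod

variable {𝒜 : Type v} {ℬ : Type w} [MeasurableSpace ℬ] {M : Market 𝒜 ℬ}

lemma Market.exists_abs_profit_div_le (hΩ : M.AllocationAssumption) (hR : M.RevenueAssumption)
    (p : ℝ) :
    ∃ C, 0 ≤ C ∧ ∀ n d t : ℝ, 0 < n → 0 ≤ d → 0 ≤ t → t ≤ n →
      |M.profit p d t / n| ≤ C * (d / n + 1) := by
  obtain ⟨C, hC0, hC⟩ := hR.exists_abs_revenue_le
  obtain ⟨C', hC'⟩ := hΩ.exists_alloc_mem_Icc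
  have hC'0 : 0 ≤ C' := (hC' 0 0 le_rfl le_rfl).1.trans (hC' 0 0 le_rfl le_rfl).2
  refine ⟨C + |p| * C', by positivity, fun n d t hn hd ht htn => ?_⟩
  have hpaid : |p * t * M.alloc d t| ≤ |p| * C' * n := by
    rw [abs_mul, abs_mul, abs_of_nonneg ht, abs_of_nonneg (hC' d t hd ht).1, mul_right_comm]
    gcongr
    exact (hC' d t hd ht).2
  rw [abs_div, abs_of_pos hn, div_le_iff₀ hn]
  calc |M.profit p d t| ≤ C * (d + t) + |p| * C' * n :=
        (abs_sub _ _).trans (add_le_add (hC d t hd ht) hpaid)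
    _ ≤ C * (d + n) + |p| * C' * (d + n) := by gcongr; linarith
    _ = (C + |p| * C') * (d / n + 1) * n := by field_simp

variable [MeasurableSpace 𝒜] {a : 𝒜} {p : ℝ}

lemma EquilibriumPeriod.integrable_profit {n : ℕ} {π : Measure ℝ}
    (X : EquilibriumPeriod.{u} M n π) [IsProbabilityMeasure (X.law a)] (hD : M.DemandAssumption)
    (hΩ : M.AllocationAssumption) (hR : M.RevenueAssumption) :
    Integrable (fun ω => M.profit p (X.D ω) (∑ j, X.Z j ω)) (X.law a) :=
  (X.integrable_revenue hD hR).sub <| (X.integrable_alloc hD hΩ fun _ h => h).bdd_mul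
    (c := |p| * n) (X.measurable_sum_Z.const_mul p).aestronglyMeasurable <| .of_forall fun ω => by
      rw [norm_mul, Real.norm_eq_abs, Real.norm_of_nonneg (X.sum_Z_nonneg ω)]
      exact mul_le_mul_of_nonneg_left (X.sum_Z_le ω) (abs_nonneg p)

lemma Market.Viable.tendsto_profit_div {ι : Type*} {l : Filter ι} {N : ι → ℕ}
    (hN : Tendsto N l atTop) (hD : M.DemandAssumption) (hΩ : M.AllocationAssumption)
    (hf : M.ChoiceAssumption) (hR : M.RevenueAssumption) (hp : 0 ≤ p) (hv : M.Viable a p)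
    (X : ∀ i, EquilibriumPeriod.{u} M (N i) (.dirac p)) [∀ i, IsProbabilityMeasure ((X i).law a)] :
    Tendsto (fun x : Σ i, (X i).Sample =>
        M.profit p ((X x.1).D x.2) (∑ j, (X x.1).Z j x.2) / N x.1)
      (withHighProb l fun i => (X i).law a) (𝓝 (M.meanFieldUtility a p)) := by
  have hN' := (tendsto_natCast_atTop_atTop (R := ℝ)).comp (hN.comp
    (tendsto_fst_withHighProb (P := fun i => (X i).law a)))
  have hμ := (hv.isMeanFieldSupply hD hΩ hf hp).1
  have hdemand := tendsto_demand X hN hD (a := a)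
  have hsupply := tendsto_supply X hN hD hΩ hf (fun _ => by simpa [ae_dirac_eq] using hp)
    (tendsto_const_nhds.congr' <| eventually_withHighProb_of_ae <| .of_forall fun _ => by
      simp [ae_dirac_eq]) hp hv
  have h := (hR.tendsto_revenue_div hN' (hD.mean_pos a) hμ hdemand hsupply).sub
    ((hsupply.const_mul p).mul (hΩ.tendsto_alloc hN' (hD.mean_pos a) hμ hdemand hsupply))
  rw [mul_right_comm, ← sub_mul] at h
  refine h.congr fun x => ?_
  simp only [sampleMean, Function.comp_apply, profit]
  ring

/-- The profit is dominated by an affine function of `(D / n - d) ^ 2`, whose mean vanishes. -/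
lemma Market.Viable.tendsto_utility [MeasurableSingletonClass 𝒜] {ι : Type*} {l : Filter ι}
    {N : ι → ℕ} (hN : Tendsto N l atTop) (hD : M.DemandAssumption) (hΩ : M.AllocationAssumption)
    (hf : M.ChoiceAssumption) (hR : M.RevenueAssumption) (hp : 0 ≤ p) (hv : M.Viable a p)
    (X : ∀ i, EquilibriumPeriod.{u} M (N i) (.dirac p)) [∀ i, IsProbabilityMeasure ((X i).law a)] :
    Tendsto (fun i => (X i).utility a) l (𝓝 (M.meanFieldUtility a p)) := by
  obtain ⟨C, hC0, hC⟩ := exists_abs_profit_div_le hΩ hR p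
  simp only [fun i => (X i).utility_dirac hD hΩ hf hR (a := a)]
  refine tendsto_integral_of_withHighProb
    (G := fun i ω => C * (M.demandMean a + 2 + ((X i).D ω / N i - M.demandMean a) ^ 2))
    (g := C * (M.demandMean a + 2))
    (fun i => ((X i).integrable_profit hD hΩ hR).div_const (N i : ℝ))
    (fun i => ?_) (hN.eventually_gt_atTop 0 |>.mono fun i hi => ?_) ?_
    (hv.tendsto_profit_div hN hD hΩ hf hR hp X)
  · have := (X i).measurable_D
    fun_prop
  · filter_upwards [(X i).ae_D_nonneg hD] with ω hω
    refine (hC _ _ _ (Nat.cast_pos.2 hi) hω ((X i).sum_Z_nonneg ω) ((X i).sum_Z_le ω)).trans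
      (mul_le_mul_of_nonneg_left ?_ hC0)
    linarith [sq_nonneg ((X i).D ω / N i - M.demandMean a - 1 / 2)]
  · have h := ENNReal.Tendsto.const_mul (tendsto_lintegral_demand X hN hD (a := a))
      (Or.inr (ENNReal.ofReal_ne_top (r := C)))
    rw [mul_zero] at h
    refine h.congr fun i => ?_
    rw [← lintegral_const_mul' _ _ ENNReal.ofReal_ne_top]
    congr with ω
    rw [← ENNReal.ofReal_mul hC0, ← Real.enorm_of_nonneg (by positivity)]
    ring_nf

end Utility

/-! ### The gradient estimator -/

lemma deltaHat_eq {n : ℕ} (hn : n ≠ 0) (ζ : ℝ) (Z : Fin n → ℝ) {ε : Fin n → ℝ}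
    (hε : ∀ i, ε i ^ 2 = 1) :
    deltaHat ζ Z ε = (sampleMean (fun i => Z i * ε i) / ζ - sampleMean Z * (sampleMean ε / ζ))
      / (1 - sampleMean ε ^ 2) := by
  have hn' : (n : ℝ) ≠ 0 := Nat.cast_ne_zero.2 hn
  have hsum : ∀ x : Fin n → ℝ, ∑ i, x i = n * sampleMean x := fun x => by
    rw [sampleMean, mul_div_cancel₀ _ hn']
  have hcov : ∑ i, (Z i - sampleMean Z) * (ε i - sampleMean ε)
      = n * (sampleMean (fun i => Z i * ε i) - sampleMean Z * sampleMean ε) := by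
    simp only [mul_sub, sub_mul, Finset.sum_sub_distrib, ← Finset.sum_mul, ← Finset.mul_sum,
      Finset.sum_const, Finset.card_univ, Fintype.card_fin, nsmul_eq_mul]
    rw [hsum Z, hsum ε, hsum fun i => Z i * ε i]
    ring
  have hvar : ∑ i, (ε i - sampleMean ε) ^ 2 = n * (1 - sampleMean ε ^ 2) := by
    simp only [sub_sq, hε, Finset.sum_add_distrib, Finset.sum_sub_distrib, ← Finset.sum_mul,
      ← Finset.mul_sum, Finset.sum_const, Finset.card_univ, Fintype.card_fin, nsmul_eq_mul]
    rw [hsum ε]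
    ring
  rw [deltaHat, hcov, hvar, mul_left_comm, mul_div_mul_left _ _ hn']
  ring

section Continuity

variable {ω r : ℝ → ℝ} {p d μ Δ : ℝ}

lemma continuousAt_upsilonHat (hω : IsRegularAllocation ω) (hp : 0 ≤ p) (hd : 0 < d) (hμ : 0 < μ)
    (hΔ : 0 ≤ Δ) :
    ContinuousAt (fun y : ℝ × ℝ × ℝ => upsilonHat ω p y.1 y.2.1 y.2.2) (d, μ, Δ) := by
  have hx := div_pos hd hμ
  have hratio : ContinuousAt (fun y : ℝ × ℝ × ℝ => y.1 / y.2.1) (d, μ, Δ) := by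
    fun_prop (disch := exact hμ.ne')
  have hΔc : ContinuousAt (fun y : ℝ × ℝ × ℝ => y.2.2) (d, μ, Δ) := by fun_prop
  rcases hω.eq_zero_or_pos with hzero | hpos
  · refine hΔc.congr ?_
    filter_upwards [hratio.eventually (lt_mem_nhds hx)] with y hy
    simp [upsilonHat, hzero _ (le_of_lt hy)]
  · have hωx := hpos _ hx
    have hω' := hω.deriv_nonneg hx
    have hωc : ContinuousAt (fun y : ℝ × ℝ × ℝ => ω (y.1 / y.2.1)) (d, μ, Δ) :=
      (hω.hasDerivAt hx).continuousAt.comp_of_eq hratio rfl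
    have hω'c : ContinuousAt (fun y : ℝ × ℝ × ℝ => deriv ω (y.1 / y.2.1)) (d, μ, Δ) :=
      (continuousAt_deriv_of_contDiffOn_Ioi hω.smooth hx).comp_of_eq hratio rfl
    have hden : 0 < μ ^ 2 * ω (d / μ) := by positivity
    have hden' : 0 < 1 + p * d * Δ * deriv ω (d / μ) / (μ ^ 2 * ω (d / μ)) := by positivity
    have hnum : ContinuousAt (fun y : ℝ × ℝ × ℝ => p * y.1 * y.2.2) (d, μ, Δ) := by fun_prop
    have hμc : ContinuousAt (fun y : ℝ × ℝ × ℝ => y.2.1 ^ 2) (d, μ, Δ) := by fun_prop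
    exact hΔc.div (continuousAt_const.add ((hnum.mul hω'c).div (hμc.mul hωc) hden.ne')) hden'.ne'

lemma continuousAt_gammaHat (hω : IsRegularAllocation ω)
    (hr : ContDiffOn ℝ (⊤ : ℕ∞) r (Set.Ioi 0)) (hp : 0 ≤ p) (hd : 0 < d) (hμ : 0 < μ)
    (hΔ : 0 ≤ Δ) :
    ContinuousAt (fun y : ℝ × ℝ × ℝ => gammaHat ω r p y.1 y.2.1 y.2.2) (d, μ, Δ) := by
  have hx := div_pos hd hμ
  have hratio : ContinuousAt (fun y : ℝ × ℝ × ℝ => y.1 / y.2.1) (d, μ, Δ) := by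
    fun_prop (disch := exact hμ.ne')
  have hcomp : ∀ {φ : ℝ → ℝ}, ContinuousAt φ (d / μ) →
      ContinuousAt (fun y : ℝ × ℝ × ℝ => φ (y.1 / y.2.1)) (d, μ, Δ) := fun hφ =>
    hφ.comp_of_eq hratio rfl
  have hωc := hcomp (hω.hasDerivAt hx).continuousAt
  have hω'c := hcomp (continuousAt_deriv_of_contDiffOn_Ioi hω.smooth hx)
  have hrc := hcomp (hasDerivAt_of_contDiffOn_Ioi hr hx).continuousAt
  have hr'c := hcomp (continuousAt_deriv_of_contDiffOn_Ioi hr hx)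
  have hμc : ContinuousAt (fun y : ℝ × ℝ × ℝ => y.2.1) (d, μ, Δ) := by fun_prop
  exact ((continuousAt_upsilonHat hω hp hd hμ hΔ).mul ((hrc.sub (continuousAt_const.mul hωc)).sub
    ((hr'c.sub (continuousAt_const.mul hω'c)).mul hratio))).sub (hωc.mul hμc)

end Continuity

lemma Market.ChoiceAssumption.tendsto_choiceMean_sub_div {𝒜 : Type v} {ℬ : Type w}
    [MeasurableSpace ℬ] {M : Market 𝒜 ℬ} (hf : M.ChoiceAssumption) (a : 𝒜) {ι : Type*}
    {l : Filter ι} {p q₀ : ℝ} {z q : ι → ℝ} (hz : Tendsto z l (𝓝 0))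
    (hz0 : ∀ᶠ i in l, z i ≠ 0) (hzp : ∀ i, |z i| ≤ p) (hq0 : ∀ i, 0 ≤ q i)
    (hq : Tendsto q l (𝓝 q₀)) (hpq : 0 ≤ p * q₀) :
    Tendsto (fun i =>
        (M.choiceMean a ((p + z i) * q i) - M.choiceMean a ((p - z i) * q i)) / 2 / z i) l
      (𝓝 (q₀ * derivWithin (M.choiceMean a) (Set.Ici 0) (p * q₀))) := by
  set F' := derivWithin (M.choiceMean a) (Set.Ici 0) (p * q₀)
  have hplus : Tendsto (fun i => (p + z i) * q i) l (𝓝[Set.Ici 0] (p * q₀)) :=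
    tendsto_nhdsWithin_iff.2 ⟨by simpa using (hz.const_add p).mul hq, .of_forall fun i =>
      mul_nonneg (by linarith [(abs_le.1 (hzp i)).1]) (hq0 i)⟩
  have hminus : Tendsto (fun i => (p - z i) * q i) l (𝓝[Set.Ici 0] (p * q₀)) :=
    tendsto_nhdsWithin_iff.2 ⟨by simpa using (hz.const_sub p).mul hq, .of_forall fun i =>
      mul_nonneg (by linarith [(abs_le.1 (hzp i)).2]) (hq0 i)⟩
  have hstep : (fun i => (p + z i) * q i - (p - z i) * q i) =O[l] z := by
    refine ((hq.isBigO_one ℝ).const_mul_left 2 |>.mul (isBigO_refl z l)).congr (fun i => ?_)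
      fun i => one_mul _
    ring
  have hlinear := ((hf.hasDerivAtFilter_choiceMean a hpq).isLittleO.comp_tendsto
    (hplus.prodMk hminus)).trans_isBigO hstep |>.tendsto_div_nhds_zero
  have h := (hlinear.div_const 2).add (hq.mul_const F')
  rw [zero_div, zero_add] at h
  refine h.congr' ?_
  filter_upwards [hz0] with i hi
  simp only [Function.comp_apply, ContinuousLinearMap.toSpanSingleton_apply, smul_eq_mul]
  field_simp
  ring

lemma ae_nonneg_perturbedPayment {p z : ℝ} (hz : |z| ≤ p) : ∀ᵐ x ∂perturbedPayment p z, 0 ≤ x :=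
  ae_perturbedPayment_iff.2 ⟨by linarith [(abs_le.1 hz).1], by linarith [(abs_le.1 hz).2]⟩

lemma tendsto_perturbedPayment {ι : Type*} {l : Filter ι} {p : ℝ} {z : ι → ℝ}
    (hz : Tendsto z l (𝓝 0)) :
    Tendsto (fun x : Σ _ : ι, ℝ => x.2) (withHighProb l fun i => perturbedPayment p (z i))
      (𝓝 p) := by
  refine tendsto_of_tendsto_of_dist tendsto_const_nhds
    ((tendsto_zero_iff_abs_tendsto_zero _).1 (hz.comp tendsto_fst_withHighProb) |>.congr' ?_)
  refine eventually_withHighProb_of_ae (.of_forall fun i => ae_perturbedPayment_iff.2 ?_)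
  simp

lemma eventually_ne_zero_of_tendsto_mul_sq {ι : Type*} {l : Filter ι} {c z : ι → ℝ}
    (h : Tendsto (fun i => c i * z i ^ 2) l atTop) : ∀ᶠ i in l, z i ≠ 0 :=
  (h.eventually_gt_atTop 0).mono fun i hi hz => by simp [hz] at hi

namespace EquilibriumPeriod

variable {𝒜 : Type v} {ℬ : Type w} [MeasurableSpace 𝒜] [MeasurableSpace ℬ] {M : Market 𝒜 ℬ}
  {p : ℝ} {a : 𝒜}

lemma ae_sign {n : ℕ} {z : ℝ} (X : EquilibriumPeriod.{u} M n (perturbedPayment p z))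
    [IsProbabilityMeasure (X.law a)] (hf : M.ChoiceAssumption) (hz : z ≠ 0) :
    ∀ᵐ ω ∂X.law a, ∀ i, (X.P i ω - p) / z = 1 ∨ (X.P i ω - p) / z = -1 :=
  ae_all_iff.2 fun i => (X.measurePreserving_P hf i).quasiMeasurePreserving.ae
    (p := fun x => (x - p) / z = 1 ∨ (x - p) / z = -1) <| ae_perturbedPayment_iff.2
      ⟨.inl (by simp [hz]), .inr (by simp [hz])⟩

lemma ae_abs_sign_le_one {n : ℕ} {z : ℝ} (X : EquilibriumPeriod.{u} M n (perturbedPayment p z))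
    [IsProbabilityMeasure (X.law a)] (hf : M.ChoiceAssumption) (i : Fin n) :
    ∀ᵐ ω ∂X.law a, |(X.P i ω - p) / z| ≤ 1 :=
  (X.measurePreserving_P hf i).quasiMeasurePreserving.ae (p := fun x => |(x - p) / z| ≤ 1) <|
    ae_perturbedPayment_iff.2 <| by simp [abs_div, div_self_le_one]

variable {ι : Type*} {l : Filter ι} {N : ι → ℕ} {z : ι → ℝ}
  (X : ∀ i, EquilibriumPeriod.{u} M (N i) (perturbedPayment p (z i)))
  [∀ i, IsProbabilityMeasure ((X i).law a)]

lemma tendsto_sampleMean_sign_div (hf : M.ChoiceAssumption)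
    (hNz : Tendsto (fun i => N i * z i ^ 2) l atTop) :
    Tendsto (fun x : Σ i, (X i).Sample =>
        sampleMean (fun k => ((X x.1).P k x.2 - p) / z x.1) / z x.1)
      (withHighProb l fun i => (X i).law a) (𝓝 0) := by
  have hsign : ∀ i, Measurable fun x : ℝ => (x - p) / z i := fun i => by fun_prop
  refine tendsto_sampleMean_div hNz (P := fun i => (X i).law a) (m := fun _ => 0)
    (W := fun i k ω => ((X i).P k ω - p) / z i)
    (fun i k => ((hsign i).comp ((X i).measurable_P k)).aemeasurable)
    (fun i => (X i).pairwise_indepFun_payment_choice ((hsign i).comp measurable_fst))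
    (fun i k => ((X i).ae_abs_sign_le_one hf k).mono fun ω hω => abs_le.1 hω)
    (fun i k => ?_) (by simp [tendsto_const_nhds])
  rw [← integral_map (f := fun x => (x - p) / z i) ((X i).measurable_P k).aemeasurable
    (hsign i).aestronglyMeasurable, ((X i).measurePreserving_P hf k).map_eq,
    integral_perturbedPayment]
  ring

lemma tendsto_sampleMean_Z_mul_sign_div (hD : M.DemandAssumption) (hΩ : M.AllocationAssumption)
    (hf : M.ChoiceAssumption) (hz : Tendsto z l (𝓝 0)) (hzp : ∀ i, |z i| ≤ p)
    (hNz : Tendsto (fun i => N i * z i ^ 2) l atTop) {q₀ : ℝ} (hpq : 0 ≤ p * q₀)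
    (hq : Tendsto (fun i => (X i).expectedAlloc a) l (𝓝 q₀)) :
    Tendsto (fun x : Σ i, (X i).Sample =>
        sampleMean (fun k => (X x.1).Z k x.2 * (((X x.1).P k x.2 - p) / z x.1)) / z x.1)
      (withHighProb l fun i => (X i).law a)
      (𝓝 (q₀ * derivWithin (M.choiceMean a) (Set.Ici 0) (p * q₀))) := by
  have hz0 := eventually_ne_zero_of_tendsto_mul_sq hNz
  have hsign : ∀ i, Measurable fun x : ℝ => (x - p) / z i := fun i => by fun_prop
  refine tendsto_sampleMean_div hNz (P := fun i => (X i).law a)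
    (W := fun i k ω => (X i).Z k ω * (((X i).P k ω - p) / z i))
    (fun i k => (((X i).measurable_Z k).mul
      ((hsign i).comp ((X i).measurable_P k))).aemeasurable)
    (fun i => (X i).pairwise_indepFun_payment_choice
      (φ := fun y => y.2 * ((y.1 - p) / z i)) (by fun_prop))
    (fun i k => ?_) (fun i k => (X i).integral_Z_mul hD hΩ hf (ae_nonneg_perturbedPayment (hzp i))
      (hsign i) (integrable_perturbedPayment _) k) ?_
  · filter_upwards [(X i).ae_abs_sign_le_one hf k] with ω hω
    refine Set.mem_Icc.2 (abs_le.1 ?_)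
    rw [abs_mul]
    exact mul_le_one₀ ((X i).abs_Z_le_one k ω) (abs_nonneg _) hω
  · refine (hf.tendsto_choiceMean_sub_div a hz hz0 hzp
      (fun i => (X i).expectedAlloc_nonneg hD hΩ) hq hpq).congr' ?_
    filter_upwards [hz0] with i hi
    rw [integral_perturbedPayment]
    congr 2
    field_simp
    ring

/-- The regression coefficient estimates the slope of the supply in the payment at a fixed
anticipated allocation, as the allocation does not see the perturbations. -/
lemma tendsto_deltaHat (hN : Tendsto N l atTop) (hD : M.DemandAssumption)
    (hΩ : M.AllocationAssumption) (hf : M.ChoiceAssumption) (hz : Tendsto z l (𝓝 0))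
    (hzp : ∀ i, |z i| ≤ p) (hNz : Tendsto (fun i => N i * z i ^ 2) l atTop) (hp : 0 ≤ p)
    (hv : M.Viable a p) :
    Tendsto (fun x : Σ i, (X i).Sample => deltaHat (z x.1) (fun k => (X x.1).Z k x.2)
        fun k => ((X x.1).P k x.2 - p) / z x.1)
      (withHighProb l fun i => (X i).law a) (𝓝 (M.supplyResponse a p)) := by
  have hz0 := eventually_ne_zero_of_tendsto_mul_sq hNz
  have hπ0 := fun i => ae_nonneg_perturbedPayment (hzp i)
  have hπ := tendsto_perturbedPayment (p := p) hz
  have hμ := hv.isMeanFieldSupply hD hΩ hf hp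
  have hω := (hΩ.regular.mem_Icc _ (div_pos (hD.mean_pos a) hμ.1).le).1
  have hsupply := tendsto_supply X hN hD hΩ hf hπ0 hπ hp hv
  have hcross := tendsto_sampleMean_Z_mul_sign_div X hD hΩ hf hz hzp hNz (mul_nonneg hp hω)
    (tendsto_expectedAlloc X hN hD hΩ hf hπ0 hπ hp hv)
  have hsign := tendsto_sampleMean_sign_div (a := a) X hf hNz
  have hsign' := hsign.mul (hz.comp (tendsto_fst_withHighProb (P := fun i => (X i).law a)))
  have h := (hcross.sub (hsupply.mul hsign)).div ((hsign'.pow 2).const_sub 1) (by simp)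
  simp only [mul_zero, sub_zero, ne_eq, OfNat.ofNat_ne_zero, not_false_eq_true, zero_pow,
    div_one] at h
  rw [Market.supplyResponse]
  refine h.congr' (eventually_withHighProb_of_ae ?_)
  filter_upwards [hz0, hN.eventually_ne_atTop 0] with i hzi hNi
  filter_upwards [(X i).ae_sign hf hzi] with ω hω
  rw [deltaHat_eq hNi _ _ fun k => sq_eq_one_iff.2 (hω k)]
  simp only [Pi.div_apply, Function.comp_apply, div_mul_cancel₀ _ hzi]

lemma tendsto_gammaHat (hN : Tendsto N l atTop) (hD : M.DemandAssumption)
    (hΩ : M.AllocationAssumption) (hf : M.ChoiceAssumption) (hR : M.RevenueAssumption)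
    (hz : Tendsto z l (𝓝 0)) (hzp : ∀ i, |z i| ≤ p)
    (hNz : Tendsto (fun i => N i * z i ^ 2) l atTop) (hp : 0 < p) (hv : M.Viable a p) :
    Tendsto (fun x : Σ i, (X i).Sample => gammaHat M.allocLim M.revenueLim p
        ((X x.1).D x.2 / N x.1) (sampleMean fun k => (X x.1).Z k x.2)
        (deltaHat (z x.1) (fun k => (X x.1).Z k x.2) fun k => ((X x.1).P k x.2 - p) / z x.1))
      (withHighProb l fun i => (X i).law a) (𝓝 (deriv (M.meanFieldUtility a) p)) := by
  have hμ := (hv.isMeanFieldSupply hD hΩ hf hp.le).1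
  have hsupply := tendsto_supply X hN hD hΩ hf (fun i => ae_nonneg_perturbedPayment (hzp i))
    (tendsto_perturbedPayment hz) hp.le hv
  have hω := (hΩ.regular.mem_Icc _ (div_pos (hD.mean_pos a) hμ).le).1
  rw [(hv.hasDerivAt_meanFieldUtility hD hΩ hf hR hp).deriv]
  exact (continuousAt_gammaHat hΩ.regular hR.smooth hp.le (hD.mean_pos a) hμ
    (mul_nonneg hω (hf.derivWithin_choiceMean_nonneg a _))).tendsto.comp <|
    (tendsto_demand X hN hD).prodMk_nhds <| hsupply.prodMk_nhds <|
      tendsto_deltaHat X hN hD hΩ hf hz hzp hNz hp.le hv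

lemma tendsto_gammaHat_sub_deriv {X : ∀ i, EquilibriumPeriod.{u} M (N i) (perturbedPayment p (z i))}
    [Finite 𝒜] [MeasurableSingletonClass 𝒜] (hN : Tendsto N l atTop) (hD : M.DemandAssumption)
    (hΩ : M.AllocationAssumption) (hf : M.ChoiceAssumption) (hR : M.RevenueAssumption)
    (hz : Tendsto z l (𝓝 0)) (hzp : ∀ i, |z i| ≤ p)
    (hNz : Tendsto (fun i => N i * z i ^ 2) l atTop) (hp : 0 < p) (hv : ∀ a, M.Viable a p)
    {ε : ∀ i, Fin (N i) → (X i).Sample → ℝ} (hε : ∀ i k ω, (X i).P k ω = p + z i * ε i k ω) :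
    Tendsto (fun x : Σ i, (X i).Sample => gammaHat M.allocLim M.revenueLim p
        ((X x.1).D x.2 / N x.1) (sampleMean fun k => (X x.1).Z k x.2)
        (deltaHat (z x.1) (fun k => (X x.1).Z k x.2) fun k => ε x.1 k x.2)
          - deriv (M.meanFieldUtility ((X x.1).A x.2)) p)
      (withHighProb l fun i => (X i).Pr) (𝓝 0) := by
  refine fun U hU => eventually_withHighProb_of_cond (fun i => (X i).measurable_A) fun a => ?_
  have (i : {i // (X i).Pr ((X i).A ⁻¹' {a}) ≠ 0}) : IsProbabilityMeasure ((X i).law a) :=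
    cond_isProbabilityMeasure i.2
  have hl : Tendsto (fun i : {i // (X i).Pr ((X i).A ⁻¹' {a}) ≠ 0} => i.1)
      (comap Subtype.val l) l := tendsto_comap
  have h := (tendsto_gammaHat (fun i : {i // (X i).Pr ((X i).A ⁻¹' {a}) ≠ 0} => X i) (hN.comp hl)
    hD hΩ hf hR (hz.comp hl) (fun i => hzp i) (hNz.comp hl) hp (hv a)).sub_const
      (deriv (M.meanFieldUtility a) p)
  rw [sub_self] at h
  have hz0 := hl.eventually (eventually_ne_zero_of_tendsto_mul_sq hNz)
  filter_upwards [h.eventually_mem hU, tendsto_fst_withHighProb.eventually hz0] with x hx hzx hA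
  have hsign : ∀ k, ((X x.1).P k x.2 - p) / z x.1 = ε x.1 k x.2 := fun k => by
    rw [hε, add_sub_cancel_left, mul_div_cancel_left₀ _ hzx]
  simpa only [Set.mem_preimage, hA, hsign, Function.comp_apply] using hx

end EquilibriumPeriod

section Schedule

variable {α : ℝ}

lemma tendsto_mul_natCast_rpow_neg (ζ : ℝ) (hα : 0 < α) :
    Tendsto (fun n : ℕ => ζ * (n : ℝ) ^ (-α)) atTop (𝓝 0) := by
  simpa using ((tendsto_rpow_neg_atTop hα).comp tendsto_natCast_atTop_atTop).const_mul ζ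

lemma abs_mul_natCast_rpow_neg_le (ζ : ℝ) (hα : 0 < α) (n : ℕ) :
    |ζ * (n : ℝ) ^ (-α)| ≤ |ζ| := by
  have hpow : (n : ℝ) ^ (-α) ≤ 1 := by
    obtain rfl | hn := n.eq_zero_or_pos
    · simp [Real.zero_rpow (neg_ne_zero.2 hα.ne')]
    · exact Real.rpow_le_one_of_one_le_of_nonpos (Nat.one_le_cast.2 hn) (by linarith)
  rw [abs_mul, abs_of_nonneg (Real.rpow_nonneg n.cast_nonneg _)]
  exact mul_le_of_le_one_right (abs_nonneg ζ) hpow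

lemma tendsto_natCast_mul_sq_rpow_neg {ζ : ℝ} (hζ : ζ ≠ 0) (hα : α < 1 / 2) :
    Tendsto (fun n : ℕ => n * (ζ * (n : ℝ) ^ (-α)) ^ 2) atTop atTop := by
  have h : Tendsto (fun n : ℕ => ζ ^ 2 * (n : ℝ) ^ (1 - 2 * α)) atTop atTop :=
    ((tendsto_rpow_atTop (by linarith)).comp tendsto_natCast_atTop_atTop).const_mul_atTop
      (by positivity)
  refine h.congr' ((eventually_gt_atTop 0).mono fun n hn => ?_)
  have hn' : (0 : ℝ) < n := Nat.cast_pos.2 hn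
  beta_reduce
  rw [mul_pow, ← Real.rpow_mul_natCast hn'.le, sub_eq_add_neg, Real.rpow_add hn', Real.rpow_one]
  ring_nf

end Schedule

theorem mainTheorem1_general {𝒜 : Type v} {ℬ : Type w} [Finite 𝒜] [MeasurableSpace 𝒜]
    [MeasurableSingletonClass 𝒜] [MeasurableSpace ℬ] (M : Market 𝒜 ℬ)
    (hD : M.DemandAssumption) (hΩ : M.AllocationAssumption) (hf : M.ChoiceAssumption)
    (hR : M.RevenueAssumption) (p : ℝ) (hp0 : 0 < p) (hp : ∀ a, M.Viable a p)
    (z : ℕ → ℝ) (hz : Tendsto z atTop (𝓝 0)) (hzp : ∀ n, |z n| ≤ p)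
    (hnz : Tendsto (fun n : ℕ => n * z n ^ 2) atTop atTop)
    (X : ∀ n : ℕ, EquilibriumPeriod.{u} M n (perturbedPayment p (z n)))
    (ε : ∀ n : ℕ, Fin n → (X n).Sample → ℝ)
    (hε : ∀ n i ω, (X n).P i ω = p + z n * ε n i ω) :
    (∀ a p', 0 < p' → M.Viable a p' →
      (∃! μ, M.IsMeanFieldSupply a p' μ) ∧
      ∀ Y : ∀ n : ℕ, EquilibriumPeriod.{u} M n (Measure.dirac p'),
        (∀ n, (Y n).Pr ((Y n).A ⁻¹' {a}) ≠ 0) →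
        Tendsto (fun n => (Y n).utility a) atTop (𝓝 (M.meanFieldUtility a p'))) ∧
    (∀ a, DifferentiableAt ℝ (M.meanFieldUtility a) p) ∧
    ∀ δ > 0, Tendsto
      (fun n : ℕ => (X n).Pr {ω | δ <
        |gammaHat M.allocLim M.revenueLim p ((X n).D ω / n) (sampleMean fun i => (X n).Z i ω)
            (deltaHat (z n) (fun i => (X n).Z i ω) (fun i => ε n i ω))
          - deriv (M.meanFieldUtility ((X n).A ω)) p|})
      atTop (𝓝 0) := by
  refine ⟨fun a p' hp' hv => ⟨?_, fun Y hY => ?_⟩,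
    fun a => ((hp a).hasDerivAt_meanFieldUtility hD hΩ hf hR hp0).differentiableAt, ?_⟩
  · exact existsUnique_of_exists_of_unique (hv.exists_isMeanFieldSupply hD hΩ hf hp'.le)
      fun _ _ => Market.IsMeanFieldSupply.unique hD hΩ hf hp'.le
  · have (n : ℕ) : IsProbabilityMeasure ((Y n).law a) := cond_isProbabilityMeasure (hY n)
    exact hv.tendsto_utility tendsto_id hD hΩ hf hR hp'.le Y
  · simpa only [sub_zero, id_eq] using tendsto_withHighProb_iff.1
      (EquilibriumPeriod.tendsto_gammaHat_sub_deriv tendsto_id hD hΩ hf hR hz hzp hnz hp0 hp hε)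

theorem mainTheorem1 {𝒜 : Type v} {ℬ : Type w} [Finite 𝒜] [MeasurableSpace 𝒜]
    [MeasurableSingletonClass 𝒜] [MeasurableSpace ℬ] (M : Market 𝒜 ℬ)
    (hD : M.DemandAssumption) (hΩ : M.AllocationAssumption) (hf : M.ChoiceAssumption)
    (hR : M.RevenueAssumption)
    (p ζ α : ℝ) (hζ : 0 < ζ) (hζp : ζ < p) (hα : 0 < α) (hα' : α < 1 / 2)
    (hp : ∀ a, M.Viable a p)
    (X : ∀ n : ℕ, EquilibriumPeriod.{u} M n (perturbedPayment p (ζ * (n : ℝ) ^ (-α))))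
    (ε : ∀ n : ℕ, Fin n → (X n).Sample → ℝ)
    (hε : ∀ n i ω, (X n).P i ω = p + ζ * (n : ℝ) ^ (-α) * ε n i ω) :
    -- the mean-field utility is well defined and is the limit of the expected utilities
    (∀ a p', 0 < p' → M.Viable a p' →
      (∃! μ, M.IsMeanFieldSupply a p' μ) ∧
      ∀ Y : ∀ n : ℕ, EquilibriumPeriod.{u} M n (Measure.dirac p'),
        (∀ n, (Y n).Pr ((Y n).A ⁻¹' {a}) ≠ 0) →
        Tendsto (fun n => (Y n).utility a) atTop (𝓝 (M.meanFieldUtility a p'))) ∧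
    -- it is differentiable at `p`
    (∀ a, DifferentiableAt ℝ (M.meanFieldUtility a) p) ∧
    -- its derivative is the limit in probability of the estimator
    ∀ δ > 0, Tendsto
      (fun n : ℕ => (X n).Pr {ω | δ <
        |gammaHat M.allocLim M.revenueLim p ((X n).D ω / n) (sampleMean fun i => (X n).Z i ω)
            (deltaHat (ζ * (n : ℝ) ^ (-α)) (fun i => (X n).Z i ω) (fun i => ε n i ω))
          - deriv (M.meanFieldUtility ((X n).A ω)) p|})
      atTop (𝓝 0) :=
  mainTheorem1_general M hD hΩ hf hR p (hζ.trans hζp) hp _ (tendsto_mul_natCast_rpow_neg ζ hα)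
    (fun n => (abs_mul_natCast_rpow_neg_le ζ hα n).trans ((abs_of_pos hζ).trans_le hζp.le))
    (tendsto_natCast_mul_sq_rpow_neg hζ.ne' hα') X ε hε
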